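/- The prioritized multi-criteria $k$-shortest simple paths problem in an undirected graph can be solved in polynomial time. In this problem one is given a finite undirected graph $G=(V,E)$, a number $q$ of criteria, for each edge $e$ a vector $\bar w(e)=(w_1(e),\dots,w_q(e))$ of non-negative integers, two vertices $s,t\in V$, and a non-negative integer $k$; all of these, including $q$ and $k$, are part of the input. For a simple path $P$ from $s$ to $t$ let $c_i(P)=\sum_{e\in P}w_i(e)$, and compare paths by the lexicographic order of the vectors $(c_1(P),\dots,c_q(P))$, criterion $1$ having the highest priority. A solution is a list $P_1,\dots,P_r$ of distinct simple paths from $s$ to $t$, where $r$ is the minimum of $k$ and the number of all simple paths from $s$ to $t$, such that $P_1\le\dots\le P_r$ in this order and $P_j\le Q$ for every $j\le r$ and every simple path $Q$ from $s$ to $t$ that is not in the list. Precisely: there are an algorithm, that is, a program for a random access machine with logarithmic cost, and a polynomial $p$ such that on every input the algorithm outputs a solution within time $p(N+k)$, where $N$ is the length of the input in bits, the graph and its weights being given by an adjacency matrix with all numbers written in binary. -/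

import Mathlib

/-! ## Random access machine with logarithmic cost

A program works with finitely many integer variables and finitely many unbounded integer arrays,
which are addressed indirectly. Every number that is computed, read or used as an address is charged
its length in binary, so that polynomial time in this model is polynomial time on Turing machines. -/

namespace Ram

/-- A memory state: the contents of the scalar variables and of the arrays. -/
structure State where
  /-- the value of each variable -/
  var : ℕ → ℕ
  /-- `arr a i` is the content of cell `i` of array `a` -/
  arr : ℕ → ℕ → ℕ

/-- The arithmetical operations (truncated subtraction, division rounded down). -/
inductive Op
  | add | sub | mul | div

/-- The value of an operation. -/
def Op.eval : Op → ℕ → ℕ → ℕ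
  | .add, x, y => x + y
  | .sub, x, y => x - y
  | .mul, x, y => x * y
  | .div, x, y => x / y

/-- Expressions: constants, variables, array cells with a computed address, operations. -/
inductive Expr
  | const (c : ℕ)
  | var (x : ℕ)
  | cell (a : ℕ) (i : Expr)
  | bin (o : Op) (e f : Expr)

/-- The value of an expression in a state. -/
def Expr.eval (m : State) : Expr → ℕ
  | .const c => c
  | .var x => m.var x
  | .cell a i => m.arr a (i.eval m)
  | .bin o e f => o.eval (e.eval m) (f.eval m)

/-- The cost of evaluating an expression: every subexpression is charged the number of binary digits
of its value, plus one. -/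
def Expr.cost (m : State) : Expr → ℕ
  | .const c => c.size + 1
  | .var x => (m.var x).size + 1
  | .cell a i => i.cost m + (m.arr a (i.eval m)).size + 1
  | .bin o e f => e.cost m + f.cost m + (o.eval (e.eval m) (f.eval m)).size + 1

/-- Programs. -/
inductive Prog
  | skip
  /-- `assign x e` is `x := e` -/
  | assign (x : ℕ) (e : Expr)
  /-- `store a i e` is `a[i] := e` -/
  | store (a : ℕ) (i e : Expr)
  | seq (c d : Prog)
  /-- run `c` if `e ≠ 0` and `d` otherwise -/
  | ite (e : Expr) (c d : Prog)
  /-- run `c` as long as `e ≠ 0` -/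
  | while (e : Expr) (c : Prog)

/-- The state after `x := v`. -/
def State.setVar (m : State) (x v : ℕ) : State :=
  { m with var := Function.update m.var x v }

/-- The state after `a[i] := v`. -/
def State.setCell (m : State) (a i v : ℕ) : State :=
  { m with arr := Function.update m.arr a (Function.update (m.arr a) i v) }

/-- `Exec c m m' t`: started in state `m`, the program `c` halts in state `m'` after time `t`. -/
inductive Exec : Prog → State → State → ℕ → Prop
  | skip (m : State) : Exec .skip m m 1
  | assign (x : ℕ) (e : Expr) (m : State) :
      Exec (.assign x e) m (m.setVar x (e.eval m)) (e.cost m + 1)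
  | store (a : ℕ) (i e : Expr) (m : State) :
      Exec (.store a i e) m (m.setCell a (i.eval m) (e.eval m)) (i.cost m + e.cost m + 1)
  | seq {c d : Prog} {m₁ m₂ m₃ : State} {t u : ℕ} :
      Exec c m₁ m₂ t → Exec d m₂ m₃ u → Exec (.seq c d) m₁ m₃ (t + u)
  | ite_true {e : Expr} {c d : Prog} {m m' : State} {t : ℕ} :
      e.eval m ≠ 0 → Exec c m m' t → Exec (.ite e c d) m m' (e.cost m + t + 1)
  | ite_false {e : Expr} {c d : Prog} {m m' : State} {t : ℕ} :
      e.eval m = 0 → Exec d m m' t → Exec (.ite e c d) m m' (e.cost m + t + 1)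
  | while_true {e : Expr} {c : Prog} {m₁ m₂ m₃ : State} {t u : ℕ} :
      e.eval m₁ ≠ 0 → Exec c m₁ m₂ t → Exec (.while e c) m₂ m₃ u →
        Exec (.while e c) m₁ m₃ (e.cost m₁ + t + u + 1)
  | while_false {e : Expr} {c : Prog} {m : State} :
      e.eval m = 0 → Exec (.while e c) m m (e.cost m + 1)

/-- The initial state: the input stands in array `0`, its length in variable `0`, and everything
else is `0`. -/
def initial (input : List ℕ) : State where
  var x := if x = 0 then input.length else 0
  arr a i := if a = 0 then input.getD i 0 else 0

/-- A final state holds the output in array `1` and its length in variable `0`. -/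
def State.Holds (m : State) (output : List ℕ) : Prop :=
  m.var 0 = output.length ∧ ∀ (i : ℕ) (h : i < output.length), m.arr 1 i = output[i]

/-- On the given input, the program halts with the given output within time `T`. -/
def Prog.ComputesWithin (c : Prog) (input output : List ℕ) (T : ℕ) : Prop :=
  ∃ (m : State) (t : ℕ), Exec c (initial input) m t ∧ m.Holds output ∧ t ≤ T

/-- The length of an input in bits, each number being written in binary with a separator. -/
def bitLength (l : List ℕ) : ℕ := (l.map fun x => x.size + 1).sum

end Ram

/-! ## The prioritized multi-criteria `k`-shortest simple paths problem -/

/-- An instance of the problem. -/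
structure KPathsInstance where
  /-- the number of vertices -/
  n : ℕ
  /-- the number of criteria -/
  q : ℕ
  /-- the undirected graph -/
  G : SimpleGraph (Fin n)
  /-- `w e i` is the weight of the edge `e` with respect to criterion `i`; criteria with a smaller
  index have higher priority, and values at pairs that are not edges of `G` play no role -/
  w : Sym2 (Fin n) → Fin q → ℕ
  /-- the source -/
  s : Fin n
  /-- the destination -/
  t : Fin n
  /-- the number of paths that are asked for -/
  k : ℕ

namespace KPathsInstance

/-- The vector of the total weights of a simple path with respect to all criteria. The order on this
type is the lexicographic one. -/
def cost (I : KPathsInstance) (P : I.G.Path I.s I.t) : Lex (Fin I.q → ℕ) :=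
  toLex fun i => (P.1.edges.map fun e => I.w e i).sum

/-- `L` lists `k` distinct lexicographically shortest simple paths from `s` to `t` in the order of
their cost, or all of them if there are fewer than `k`. -/
structure IsSolution (I : KPathsInstance) (L : List (I.G.Path I.s I.t)) : Prop where
  nodup : L.Nodup
  length_le : L.length ≤ I.k
  all_of_lt : L.length < I.k → ∀ P, P ∈ L
  sorted : L.Pairwise fun P Q => I.cost P ≤ I.cost Q
  shortest : ∀ P ∈ L, ∀ Q, Q ∉ L → I.cost P ≤ I.cost Q

open Classical in
/-- The instance as a list of numbers: `n, q, s, t, k`, followed by the matrix whose entry at `(u, v)`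
is `1, w₁, …, w_q` if `uv` is an edge with these weights and `0, 0, …, 0` otherwise. -/
noncomputable def encode (I : KPathsInstance) : List ℕ :=
  [I.n, I.q, I.s.val, I.t.val, I.k] ++
    (List.finRange I.n).flatMap fun u => (List.finRange I.n).flatMap fun v =>
      if I.G.Adj u v then 1 :: (List.finRange I.q).map fun i => I.w s(u, v) i
      else 0 :: (List.finRange I.q).map fun _ => 0

/-- A list of paths as a list of numbers: the number of paths, followed, for every path, by the number
of its vertices and its vertices from `s` to `t`. -/
def encodePaths (I : KPathsInstance) (L : List (I.G.Path I.s I.t)) : List ℕ :=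
  L.length :: L.flatMap fun P => P.1.support.length :: P.1.support.map fun v => v.val

end KPathsInstance

/-! Scalar weights. If the criteria of an edge are read as digits in a base that exceeds all totals
of simple paths, the lexicographic order becomes the order of single numbers whose length is
polynomial (`walkWeight_lt_of_cost_lt`).

Beam search. With a loop of weight `0` at `t`, a simple path becomes a sequence of vertices of any
length from its own on. The key of a prefix is its weight plus the least weight of a walk from its
last vertex to `t` that avoids the earlier vertices. Weights are non-negative, so cycles can be cut
out of this walk, and a finite key is the least weight of a simple path that extends the prefix
(`key_le_walkWeight`, `exists_path_of_key_lt`). From level to level the search keeps, among the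
one-vertex extensions of the kept prefixes, the `k` with the smallest keys, ties being broken by the
code of the prefix. The invariant `IsBeam` says that a path either has its prefix in the beam, or
the beam is full and none of its keys exceeds the weight of the path. It persists (`IsBeam.succ`)
because every kept prefix of finite key has a best completion, hence a one-vertex extension with no
larger key: a path that has been cut off keeps `k` competitors that are no worse. At level `n` the
prefixes are whole paths and their keys are their weights (`IsBeam.exists_isSolution`).

Running time. The program is written with `for` loops and divided into phases. Within a phase no
loop bound and no right factor of a product is written to (`Tame`), so a step lengthens the numbers
by an amount that does not depend on the lengths reached so far. Lengths thus grow linearly with the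
number of steps, which is polynomial in the loop bounds (`Cmd.exec_le`). A number computed in one
phase may be a factor in the next, and a fixed number of phases keeps everything polynomial
(`exec_phases`). -/

/-! ## Structured programs

Programs with bounded loops only, for which there are a total semantics and a time bound that can be
read off from the text of the program. -/

namespace Ram

/-- Programs with `for` loops; `loop x y c` runs `c` for `x = 0, 1, …, y - 1`. -/
inductive Cmd
  | skip
  | assign (x : ℕ) (e : Expr)
  | store (a : ℕ) (i e : Expr)
  | seq (c d : Cmd)
  | ite (e : Expr) (c d : Cmd)
  | loop (x y : ℕ) (c : Cmd)

namespace Cmd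

/-- The variables that are assigned to. -/
def vars : Cmd → List ℕ
  | skip => []
  | assign x _ => [x]
  | store _ _ _ => []
  | seq c d => c.vars ++ d.vars
  | ite _ c d => c.vars ++ d.vars
  | loop x _ c => x :: c.vars

/-- The arrays that are written to. -/
def arrs : Cmd → List ℕ
  | skip => []
  | assign _ _ => []
  | store a _ _ => [a]
  | seq c d => c.arrs ++ d.arrs
  | ite _ c d => c.arrs ++ d.arrs
  | loop _ _ c => c.arrs

/-- The variables that bound loops. -/
def bounds : Cmd → List ℕ
  | seq c d => c.bounds ++ d.bounds
  | ite _ c d => c.bounds ++ d.bounds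
  | loop _ y c => y :: c.bounds
  | _ => []

/-- The translation into a program of the machine. -/
def toProg : Cmd → Prog
  | skip => .skip
  | assign x e => .assign x e
  | store a i e => .store a i e
  | seq c d => .seq c.toProg d.toProg
  | ite e c d => .ite e c.toProg d.toProg
  | loop x y c => .seq (.assign x (.const 0)) (.while (.bin .sub (.var y) (.var x))
      (.seq c.toProg (.assign x (.bin .add (.var x) (.const 1)))))

/-- `iter f x i m` is the state reached from `m` after `i` rounds of a loop with counter `x`
and body `f`. -/
def iter (f : State → State) (x : ℕ) : ℕ → State → State
  | 0, m => m.setVar x 0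
  | i + 1, m => (f (iter f x i m)).setVar x (i + 1)

/-- The final state of a run. -/
def run : Cmd → State → State
  | skip, m => m
  | assign x e, m => m.setVar x (e.eval m)
  | store a i e, m => m.setCell a (i.eval m) (e.eval m)
  | seq c d, m => d.run (c.run m)
  | ite e c d, m => if e.eval m ≠ 0 then c.run m else d.run m
  | loop x y c, m => iter c.run x (m.var y) m

end Cmd

@[simp] theorem State.setVar_var (m : State) (x v y : ℕ) :
    (m.setVar x v).var y = if y = x then v else m.var y := by
  simp [State.setVar, Function.update_apply]

@[simp] theorem State.setVar_arr (m : State) (x v : ℕ) : (m.setVar x v).arr = m.arr := rfl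

@[simp] theorem State.setCell_var (m : State) (a i v : ℕ) : (m.setCell a i v).var = m.var := rfl

@[simp] theorem State.setCell_arr (m : State) (a i v b j : ℕ) :
    (m.setCell a i v).arr b j = if b = a ∧ j = i then v else m.arr b j := by
  simp only [State.setCell, Function.update_apply]
  split_ifs with h₁ h₂ <;> simp_all

/-- The states `m` and `m'` agree outside the variables `X` and the arrays `Y`. -/
structure Frame (X Y : List ℕ) (m m' : State) : Prop where
  var : ∀ x, x ∉ X → m'.var x = m.var x
  arr : ∀ a, a ∉ Y → ∀ i, m'.arr a i = m.arr a i

theorem Frame.refl (X Y : List ℕ) (m : State) : Frame X Y m m := ⟨fun _ _ => rfl, fun _ _ _ => rfl⟩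

theorem Frame.trans {X Y : List ℕ} {m₁ m₂ m₃ : State} (h : Frame X Y m₁ m₂) (h' : Frame X Y m₂ m₃) :
    Frame X Y m₁ m₃ :=
  ⟨fun x hx => (h'.var x hx).trans (h.var x hx), fun a ha i => (h'.arr a ha i).trans (h.arr a ha i)⟩

theorem Frame.mono {X Y X' Y' : List ℕ} {m₁ m₂ : State} (h : Frame X Y m₁ m₂) (hX : X ⊆ X')
    (hY : Y ⊆ Y') : Frame X' Y' m₁ m₂ :=
  ⟨fun x hx => h.var x fun h => hx (hX h), fun a ha i => h.arr a (fun h => ha (hY h)) i⟩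

theorem Frame.setVar {X Y : List ℕ} {m m' : State} (h : Frame X Y m m') {x : ℕ} (hx : x ∈ X)
    (v : ℕ) : Frame X Y m (m'.setVar x v) := by
  refine ⟨fun y hy => ?_, fun a ha i => by simpa using h.arr a ha i⟩
  have : y ≠ x := fun h => hy (h ▸ hx)
  simpa [this] using h.var y hy

namespace Cmd

theorem frame_iter {X Y : List ℕ} {f : State → State} {x : ℕ} (hx : x ∈ X)
    (hf : ∀ m, Frame X Y m (f m)) (i : ℕ) (m : State) : Frame X Y m (iter f x i m) := by
  induction i with
  | zero => exact (Frame.refl X Y m).setVar hx _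
  | succ i ih => exact (ih.trans (hf _)).setVar hx _

theorem frame_run (c : Cmd) (m : State) : Frame c.vars c.arrs m (c.run m) := by
  induction c generalizing m with
  | skip => exact Frame.refl _ _ _
  | assign x e => exact (Frame.refl _ _ _).setVar (by simp [vars]) _
  | store a i e =>
    refine ⟨fun _ _ => rfl, fun b hb j => ?_⟩
    have : b ≠ a := by simpa [arrs] using hb
    simp [run, this]
  | seq c d hc hd =>
    exact ((hc m).mono (by simp [vars]) (by simp [arrs])).trans
      ((hd _).mono (by simp [vars]) (by simp [arrs]))
  | ite e c d hc hd =>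
    simp only [run]
    split_ifs
    · exact (hc m).mono (by simp [vars]) (by simp [arrs])
    · exact (hd m).mono (by simp [vars]) (by simp [arrs])
  | loop x y c hc =>
    exact frame_iter (by simp [vars])
      (fun m => (hc m).mono (by simp [vars]) (by simp [arrs])) _ m

theorem run_var {c : Cmd} {x : ℕ} (hx : x ∉ c.vars) (m : State) : (c.run m).var x = m.var x :=
  (c.frame_run m).var x hx

theorem run_arr {c : Cmd} {a : ℕ} (ha : a ∉ c.arrs) (m : State) (i : ℕ) :
    (c.run m).arr a i = m.arr a i :=
  (c.frame_run m).arr a ha i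

/-- The invariant rule for loops. -/
theorem loop_induction {x y : ℕ} {c : Cmd} {m : State} (Inv : ℕ → State → Prop)
    (h0 : Inv 0 (m.setVar x 0))
    (hs : ∀ i m', i < m.var y → m'.var x = i → Frame (x :: c.vars) c.arrs m m' → Inv i m' →
      Inv (i + 1) ((c.run m').setVar x (i + 1))) :
    Inv (m.var y) ((loop x y c).run m) := by
  have key : ∀ i, i ≤ m.var y → Inv i (iter c.run x i m) := by
    intro i
    induction i with
    | zero => exact fun _ => h0
    | succ i ih =>
      intro hi
      refine hs i _ hi ?_ ?_ (ih (by omega))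
      · cases i <;> simp [iter]
      · exact frame_iter (by simp) (fun m => (c.frame_run m).mono (by simp) (by simp)) _ m
  exact key _ le_rfl

end Cmd

/-! ### The time bound -/

/-- A bound for the cost of an expression, relative to the size of the numbers in the memory. -/
def Expr.weight : Expr → ℕ
  | .const c => c.size + 1
  | .var _ => 1
  | .cell _ i => i.weight + 1
  | .bin _ e f => e.weight + f.weight + 1

/-- The expression is a constant, a variable outside `X` or a cell of an array outside `Y`. -/
def Expr.IsStatic (X Y : List ℕ) : Expr → Prop
  | .const _ => True
  | .var x => x ∉ X
  | .cell a _ => a ∉ Y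
  | .bin _ _ _ => False

instance (X Y : List ℕ) : (e : Expr) → Decidable (e.IsStatic X Y)
  | .const _ => inferInstanceAs (Decidable True)
  | .var _ => inferInstanceAs (Decidable (_ ∉ _))
  | .cell _ _ => inferInstanceAs (Decidable (_ ∉ _))
  | .bin _ _ _ => inferInstanceAs (Decidable False)

/-- The right factor of every product in the expression is static. -/
def Expr.Tame (X Y : List ℕ) : Expr → Prop
  | .const _ => True
  | .var _ => True
  | .cell _ i => i.Tame X Y
  | .bin o e f => e.Tame X Y ∧ f.Tame X Y ∧ (match o with | .mul => f.IsStatic X Y | _ => True)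

instance Expr.decidableTame (X Y : List ℕ) : (e : Expr) → Decidable (e.Tame X Y)
  | .const _ => inferInstanceAs (Decidable True)
  | .var _ => inferInstanceAs (Decidable True)
  | .cell _ i => decidableTame X Y i
  | .bin o e f =>
    have := decidableTame X Y e
    have := decidableTame X Y f
    match o with
    | .mul => inferInstanceAs (Decidable (_ ∧ _ ∧ f.IsStatic X Y))
    | .add => inferInstanceAs (Decidable (_ ∧ _ ∧ True))
    | .sub => inferInstanceAs (Decidable (_ ∧ _ ∧ True))
    | .div => inferInstanceAs (Decidable (_ ∧ _ ∧ True))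

/-- All expressions are tame, loop bounds are static, and loop counters are not assigned to in the
body of the loop. -/
def Cmd.Tame (X Y : List ℕ) : Cmd → Prop
  | .skip => True
  | .assign _ e => e.Tame X Y
  | .store _ i e => i.Tame X Y ∧ e.Tame X Y
  | .seq c d => c.Tame X Y ∧ d.Tame X Y
  | .ite e c d => e.Tame X Y ∧ c.Tame X Y ∧ d.Tame X Y
  | .loop x y c => y ∉ X ∧ x ∉ c.vars ∧ c.Tame X Y

instance Cmd.decidableTame (X Y : List ℕ) : (c : Cmd) → Decidable (c.Tame X Y)
  | .skip => inferInstanceAs (Decidable True)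
  | .assign _ e => inferInstanceAs (Decidable (e.Tame X Y))
  | .store _ i e => inferInstanceAs (Decidable (i.Tame X Y ∧ e.Tame X Y))
  | .seq c d =>
    have := decidableTame X Y c
    have := decidableTame X Y d
    inferInstanceAs (Decidable (c.Tame X Y ∧ d.Tame X Y))
  | .ite e c d =>
    have := decidableTame X Y c
    have := decidableTame X Y d
    inferInstanceAs (Decidable (e.Tame X Y ∧ c.Tame X Y ∧ d.Tame X Y))
  | .loop x y c =>
    have := decidableTame X Y c
    inferInstanceAs (Decidable (y ∉ X ∧ x ∉ c.vars ∧ c.Tame X Y))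

/-- All numbers in the memory have at most `S` binary digits. -/
structure State.Bounded (m : State) (S : ℕ) : Prop where
  var : ∀ x, (m.var x).size ≤ S
  arr : ∀ a i, (m.arr a i).size ≤ S

theorem State.Bounded.mono {m : State} {S S' : ℕ} (h : m.Bounded S) (hS : S ≤ S') : m.Bounded S' :=
  ⟨fun x => (h.var x).trans hS, fun a i => (h.arr a i).trans hS⟩

theorem State.Bounded.setVar {m : State} {S : ℕ} (h : m.Bounded S) {x v : ℕ} (hv : v.size ≤ S) :
    (m.setVar x v).Bounded S := by
  refine ⟨fun y => ?_, h.arr⟩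
  rw [State.setVar_var]
  split_ifs
  · exact hv
  · exact h.var y

theorem State.Bounded.setCell {m : State} {S : ℕ} (h : m.Bounded S) {a i v : ℕ} (hv : v.size ≤ S) :
    (m.setCell a i v).Bounded S := by
  refine ⟨h.var, fun b j => ?_⟩
  rw [State.setCell_arr]
  split_ifs
  · exact hv
  · exact h.arr b j

theorem size_add_le {a b S : ℕ} (ha : a.size ≤ S) (hb : b.size ≤ S) : (a + b).size ≤ S + 1 := by
  rw [Nat.size_le] at *
  rw [pow_succ]
  omega

theorem size_mul_le {a b S T : ℕ} (ha : a.size ≤ S) (hb : b.size ≤ T) : (a * b).size ≤ S + T := by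
  rw [Nat.size_le] at *
  rw [pow_add]
  exact Nat.mul_lt_mul'' ha hb

/-- The variables outside `X` and the arrays outside `Y` contain only numbers with at most `R`
binary digits. -/
structure State.StaticBounded (m : State) (X Y : List ℕ) (R : ℕ) : Prop where
  var : ∀ x, x ∉ X → (m.var x).size ≤ R
  arr : ∀ a, a ∉ Y → ∀ i, (m.arr a i).size ≤ R

theorem Frame.staticBounded {X Y : List ℕ} {m m' : State} {R : ℕ} (h : Frame X Y m m')
    (hm : m.StaticBounded X Y R) : m'.StaticBounded X Y R :=
  ⟨fun x hx => h.var x hx ▸ hm.var x hx, fun a ha i => h.arr a ha i ▸ hm.arr a ha i⟩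

theorem Expr.one_le_weight (e : Expr) : 1 ≤ e.weight := by
  cases e <;> simp [Expr.weight]

theorem Expr.size_static_le {X Y : List ℕ} {m : State} {R : ℕ} (hR : m.StaticBounded X Y R)
    {e : Expr} (he : e.IsStatic X Y) : (e.eval m).size ≤ e.weight * (R + 1) := by
  have key : R ≤ e.weight * (R + 1) := by nlinarith [e.one_le_weight]
  cases e with
  | const c => simp only [Expr.eval, Expr.weight]; nlinarith
  | var x => exact (hR.var x he).trans key
  | cell a i => exact (hR.arr a he _).trans key
  | bin o e f => exact he.elim

/-- A sum is at most one digit longer than its terms, and differences and quotients are not longer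
than their left operand. A product adds the length of its right factor, which is static and hence
bounded independently of `S`. -/
theorem Expr.size_eval_le {X Y : List ℕ} {m : State} {S R : ℕ} (hS : m.Bounded S)
    (hR : m.StaticBounded X Y R) {e : Expr} (he : e.Tame X Y) :
    (e.eval m).size ≤ S + e.weight * (R + 1) := by
  induction e with
  | const c => simp only [Expr.eval, Expr.weight]; nlinarith
  | var x => exact (hS.var x).trans (Nat.le_add_right _ _)
  | cell a i _ => exact (hS.arr a _).trans (Nat.le_add_right _ _)
  | bin o e f ihe ihf =>
    obtain ⟨he, hf, ho⟩ := he
    have h1 := ihe he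
    have h2 := ihf hf
    simp only [Expr.eval, Expr.weight]
    have h3 : S + e.weight * (R + 1) ≤ S + (e.weight + f.weight + 1) * (R + 1) := by nlinarith
    cases o with
    | add =>
      refine (size_add_le (S := S + (e.weight + f.weight) * (R + 1)) ?_ ?_).trans ?_ <;> nlinarith
    | sub => exact ((Nat.size_le_size (Nat.sub_le _ _)).trans h1).trans h3
    | div => exact ((Nat.size_le_size (Nat.div_le_self _ _)).trans h1).trans h3
    | mul =>
      refine (size_mul_le h1 (Expr.size_static_le hR ho)).trans ?_
      nlinarith

theorem Expr.cost_le {X Y : List ℕ} {m : State} {S R : ℕ} (hS : m.Bounded S)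
    (hR : m.StaticBounded X Y R) {e : Expr} (he : e.Tame X Y) :
    e.cost m ≤ e.weight * (S + e.weight * (R + 1) + 1) := by
  -- The weight inside the parentheses is frozen as `W`, so that the bounds for the subexpressions
  -- have the same second factor and can be added.
  suffices h : ∀ W, e.weight ≤ W → e.cost m ≤ e.weight * (S + W * (R + 1) + 1) from h _ le_rfl
  intro W hW
  have own := Expr.size_eval_le hS hR he
  have hWR := Nat.mul_le_mul_right (R + 1) hW
  induction e with
  | const c => simp only [Expr.cost, Expr.weight]; nlinarith
  | var x => have := hS.var x; simp only [Expr.cost, Expr.weight]; nlinarith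
  | cell a i ih =>
    have hi : i.weight ≤ W := by simp only [Expr.weight] at hW; omega
    have := ih he hi (Expr.size_eval_le hS hR he) (Nat.mul_le_mul_right (R + 1) hi)
    have := hS.arr a (i.eval m)
    simp only [Expr.cost, Expr.weight]
    nlinarith
  | bin o e f ihe ihf =>
    simp only [Expr.weight] at hW
    have he' : e.weight ≤ W := by omega
    have hf' : f.weight ≤ W := by omega
    have h1 := ihe he.1 he' (Expr.size_eval_le hS hR he.1) (Nat.mul_le_mul_right (R + 1) he')
    have h2 := ihf he.2.1 hf' (Expr.size_eval_le hS hR he.2.1) (Nat.mul_le_mul_right (R + 1) hf')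
    simp only [Expr.cost, Expr.eval] at own ⊢
    have h3 := own.trans (Nat.add_le_add_left hWR S)
    simp only [Expr.weight]
    nlinarith

open Polynomial in
/-- A bound for the running time and for the growth of the numbers in terms of a bound for the
numbers of rounds of the loops. -/
noncomputable def Cmd.weight : Cmd → Polynomial ℕ
  | .skip => 1
  | .assign _ e => C (e.weight + 1)
  | .store _ i e => C (i.weight + e.weight + 1)
  | .seq c d => c.weight + d.weight
  | .ite e c d => C (e.weight + 1) + c.weight + d.weight
  | .loop _ _ c => (X + 1) * (c.weight + 12)

theorem Cmd.iter_var_self (f : State → State) (x i : ℕ) (m : State) :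
    (iter f x i m).var x = i := by
  cases i <;> simp [iter]

/-- Together with `Frame` this shows that loop bounds keep their initial values, so a bound for them
passes on to later commands and rounds. -/
theorem Cmd.bounds_static {X Y : List ℕ} {d : Cmd} (hd : d.Tame X Y) : ∀ y ∈ d.bounds, y ∉ X := by
  induction d with
  | seq c d ihc ihd =>
    intro y hy
    rcases List.mem_append.1 hy with h | h
    exacts [ihc hd.1 y h, ihd hd.2 y h]
  | ite e c d ihc ihd =>
    intro y hy
    rcases List.mem_append.1 hy with h | h
    exacts [ihc hd.2.1 y h, ihd hd.2.2 y h]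
  | loop x z c ih =>
    intro y hy
    rcases List.mem_cons.1 hy with h | h
    exacts [h ▸ hd.1, ih hd.2.2 y h]
  | _ => intro y hy; simp [Cmd.bounds] at hy

theorem le_budget {t A B S r : ℕ} (h : t ≤ A * (S + A * r + 1)) (hAB : A ≤ B) :
    t ≤ A * (S + B * r + 1) :=
  h.trans (Nat.mul_le_mul_left _ (by have := Nat.mul_le_mul_right r hAB; omega))

/-- A tame program halts, within a time that is bounded in terms of its text. -/
theorem Cmd.exec_le {X Y : List ℕ} {R L : ℕ} (c : Cmd) (hc : c.Tame X Y) (hX : c.vars ⊆ X)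
    (hY : c.arrs ⊆ Y) (m : State) (S : ℕ) (hR : m.StaticBounded X Y R) (hS : m.Bounded S)
    (hL : ∀ y ∈ c.bounds, m.var y ≤ L) :
    (∃ t, Exec c.toProg m (c.run m) t ∧
      t ≤ c.weight.eval L * (S + c.weight.eval L * (R + 1) + 1)) ∧
    (c.run m).Bounded (S + c.weight.eval L * (R + 1)) := by
  induction c generalizing m S with
  | skip =>
    exact ⟨⟨1, .skip m, by simp [Cmd.weight]⟩, hS.mono (by simp)⟩
  | assign x e =>
    refine ⟨⟨_, .assign x e m, ?_⟩, ?_⟩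
    · have := Expr.cost_le hS hR hc
      simp only [Cmd.weight, Polynomial.eval_C]
      nlinarith
    · refine (hS.mono (Nat.le_add_right _ _)).setVar ((Expr.size_eval_le hS hR hc).trans ?_)
      simp only [Cmd.weight, Polynomial.eval_C]
      nlinarith
  | store a i e =>
    refine ⟨⟨_, .store a i e m, ?_⟩, ?_⟩
    · have h1 := le_budget (Expr.cost_le hS hR hc.1)
        (show i.weight ≤ i.weight + e.weight + 1 by omega)
      have h2 := le_budget (Expr.cost_le hS hR hc.2)
        (show e.weight ≤ i.weight + e.weight + 1 by omega)
      simp only [Cmd.weight, Polynomial.eval_C]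
      nlinarith
    · refine (hS.mono (Nat.le_add_right _ _)).setCell ((Expr.size_eval_le hS hR hc.2).trans ?_)
      simp only [Cmd.weight, Polynomial.eval_C]
      nlinarith
  | seq c d ihc ihd =>
    simp only [Cmd.vars, Cmd.arrs, Cmd.bounds, List.append_subset, List.mem_append] at hX hY hL
    obtain ⟨⟨t, ht, htle⟩, hS'⟩ := ihc hc.1 hX.1 hY.1 m S hR hS fun y hy => hL y (.inl hy)
    have hF := (c.frame_run m).mono hX.1 hY.1
    obtain ⟨⟨u, hu, hule⟩, hS''⟩ := ihd hc.2 hX.2 hY.2 _ _ (hF.staticBounded hR) hS'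
      fun y hy => (hF.var y (bounds_static hc.2 y hy)).trans_le (hL y (.inr hy))
    simp only [Cmd.weight, Polynomial.eval_add]
    refine ⟨⟨t + u, .seq ht hu, ?_⟩, hS''.mono (le_of_eq (by ring))⟩
    have h1 := le_budget htle (Nat.le_add_right _ (d.weight.eval L))
    rw [add_mul]
    exact Nat.add_le_add h1 (hule.trans (le_of_eq (by ring)))
  | ite e c d ihc ihd =>
    simp only [Cmd.vars, Cmd.arrs, Cmd.bounds, List.append_subset, List.mem_append] at hX hY hL
    have he := Expr.cost_le hS hR hc.1
    by_cases h : e.eval m = 0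
    · obtain ⟨⟨t, ht, htle⟩, hS'⟩ := ihd hc.2.2 hX.2 hY.2 m S hR hS fun y hy => hL y (.inr hy)
      have hr : (Cmd.ite e c d).run m = d.run m := by simp [Cmd.run, h]
      rw [hr]
      simp only [Cmd.weight, Polynomial.eval_add, Polynomial.eval_C]
      refine ⟨⟨_, .ite_false h ht, ?_⟩, hS'.mono (by nlinarith)⟩
      have h1 := le_budget he (show _ ≤ e.weight + 1 + c.weight.eval L + d.weight.eval L by omega)
      have h2 := le_budget htle (show _ ≤ e.weight + 1 + c.weight.eval L + d.weight.eval L by omega)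
      have h3 : 1 ≤ S + (e.weight + 1 + c.weight.eval L + d.weight.eval L) * (R + 1) + 1 := by omega
      generalize S + (e.weight + 1 + c.weight.eval L + d.weight.eval L) * (R + 1) + 1 = Z at h1 h2 h3 ⊢
      nlinarith
    · obtain ⟨⟨t, ht, htle⟩, hS'⟩ := ihc hc.2.1 hX.1 hY.1 m S hR hS fun y hy => hL y (.inl hy)
      have hr : (Cmd.ite e c d).run m = c.run m := by simp [Cmd.run, h]
      rw [hr]
      simp only [Cmd.weight, Polynomial.eval_add, Polynomial.eval_C]
      refine ⟨⟨_, .ite_true h ht, ?_⟩, hS'.mono (by nlinarith)⟩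
      have h1 := le_budget he (show _ ≤ e.weight + 1 + c.weight.eval L + d.weight.eval L by omega)
      have h2 := le_budget htle (show _ ≤ e.weight + 1 + c.weight.eval L + d.weight.eval L by omega)
      have h3 : 1 ≤ S + (e.weight + 1 + c.weight.eval L + d.weight.eval L) * (R + 1) + 1 := by omega
      generalize S + (e.weight + 1 + c.weight.eval L + d.weight.eval L) * (R + 1) + 1 = Z at h1 h2 h3 ⊢
      nlinarith
  | loop x y c ih =>
    obtain ⟨hy, hx, hc⟩ := hc
    simp only [Cmd.vars, Cmd.arrs, Cmd.bounds, List.cons_subset, List.mem_cons] at hX hY hL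
    set B := c.weight.eval L with hB
    set s : ℕ → State := fun i => iter c.run x i m with hs
    have hF : ∀ i, Frame X Y m (s i) := fun i =>
      frame_iter hX.1 (fun m => (c.frame_run m).mono hX.2 hY) i m
    have hT : m.var y ≤ L := hL y (.inl rfl)
    have body : ∀ i S', (s i).Bounded S' → _ := fun i S' hS' =>
      ih hc hX.2 hY (s i) S' ((hF i).staticBounded hR) hS' fun z hz =>
        ((hF i).var z (bounds_static hc z hz)).trans_le (hL z (.inr hz))
    -- Each round adds at most `B * (R + 1)` digits, the same amount every time, because `R`
    -- concerns only what the loop does not write.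
    have hbd : ∀ i ≤ m.var y, (s i).Bounded (S + i * B * (R + 1)) := by
      intro i
      induction i with
      | zero => exact fun _ => (hS.mono (by simp)).setVar (by simp)
      | succ i ihi =>
        intro hi
        refine ((body i _ (ihi (by omega))).2.mono ?_).setVar ?_
        · exact le_of_eq (by ring)
        · exact ((Nat.size_le_size hi).trans (hS.var y)).trans (Nat.le_add_right _ _)
    -- `Z` bounds the lengths of all numbers during the loop. A round costs at most `4 * Z` for the
    -- test, `6 * Z` for the counter and `B * Z` for the body; the `12` leaves room for the
    -- initialization and the last test.
    set Z := S + (L + 1) * (B + 12) * (R + 1) + 1 with hZ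
    have hSZ : S + 1 ≤ Z := by rw [hZ]; nlinarith [Nat.zero_le ((L + 1) * (B + 12) * (R + 1))]
    have test : ∀ i ≤ m.var y,
        (Expr.bin .sub (.var y) (.var x)).cost (s i) + 1 ≤ 4 * Z := by
      intro i hi
      have h1 : (s i).var y = m.var y := (hF i).var y hy
      have h2 : (s i).var x = i := iter_var_self _ _ _ _
      have h3 := (Nat.size_le_size hi).trans (hS.var y)
      have h4 := (Nat.size_le_size (Nat.sub_le (m.var y) i)).trans (hS.var y)
      have h5 := hS.var y
      simp only [Expr.cost, Expr.eval, Op.eval, h1, h2]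
      omega
    -- Induction on the number `j` of rounds that are left.
    have main : ∀ j i, i + j = m.var y → ∃ t, Exec (.while (.bin .sub (.var y) (.var x))
        (.seq c.toProg (.assign x (.bin .add (.var x) (.const 1))))) (s i) (s (m.var y)) t ∧
        t ≤ j * ((B + 10) * Z) + 4 * Z := by
      intro j
      induction j with
      | zero =>
        intro i hi
        obtain rfl : i = m.var y := by omega
        refine ⟨_, .while_false ?_, ?_⟩
        · have h1 : (s (m.var y)).var y = m.var y := (hF _).var y hy
          have h2 : (s (m.var y)).var x = m.var y := iter_var_self _ _ _ _
          simp [Expr.eval, Op.eval, h1, h2]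
        · simpa using test _ le_rfl
      | succ j ihj =>
        intro i hi
        obtain ⟨t, ht, htle⟩ := ihj (i + 1) (by omega)
        obtain ⟨⟨u, hu, hule⟩, -⟩ := body i _ (hbd i (by omega))
        have h1 : (s i).var y = m.var y := (hF i).var y hy
        have h2 : (s i).var x = i := iter_var_self _ _ _ _
        have h3 : (c.run (s i)).var x = i := (run_var hx _).trans h2
        have ha : Exec (.assign x (.bin .add (.var x) (.const 1))) (c.run (s i)) (s (i + 1))
            ((Expr.bin .add (.var x) (.const 1)).cost (c.run (s i)) + 1) := by
          have := Exec.assign x (.bin .add (.var x) (.const 1)) (c.run (s i))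
          simp only [Expr.eval, Op.eval, h3] at this
          exact this
        refine ⟨_, .while_true ?_ (.seq hu ha) ht, ?_⟩
        · simp only [Expr.eval, Op.eval, h1, h2]
          omega
        · have h4 := test i (by omega)
          have h5 := (Nat.size_le_size (show i ≤ m.var y by omega)).trans (hS.var y)
          have h6 := (Nat.size_le_size (show i + 1 ≤ m.var y by omega)).trans (hS.var y)
          have h7 : (Expr.bin .add (.var x) (.const 1)).cost (c.run (s i)) + 1 ≤ 6 * Z := by
            simp only [Expr.cost, Expr.eval, Op.eval, h3, Nat.size_one]
            omega
          have h8 : S + i * B * (R + 1) + B * (R + 1) + 1 ≤ Z := by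
            have : (i + 1) * B ≤ (L + 1) * (B + 12) := Nat.mul_le_mul (by omega) (by omega)
            have := Nat.mul_le_mul_right (R + 1) this
            rw [hZ]
            nlinarith
          have h9 : u ≤ B * Z := hule.trans (Nat.mul_le_mul_left _ h8)
          nlinarith
    obtain ⟨t, ht, htle⟩ := main (m.var y) 0 (by omega)
    have hw : (Cmd.loop x y c).weight.eval L = (L + 1) * (B + 12) := by
      simp [Cmd.weight, hB]
    rw [hw]
    refine ⟨⟨_, .seq (.assign x (.const 0) m) ht, ?_⟩, (hbd _ le_rfl).mono ?_⟩
    · have h1 : m.var y * ((B + 10) * Z) ≤ L * ((B + 10) * Z) := Nat.mul_le_mul_right _ hT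
      have h2 : (Expr.const 0).cost m + 1 = 2 := by simp [Expr.cost]
      rw [h2]
      nlinarith
    · have : m.var y * B ≤ (L + 1) * (B + 12) := Nat.mul_le_mul (by omega) (by omega)
      have := Nat.mul_le_mul_right (R + 1) this
      omega

/-- A phase of a computation: the program is tame with respect to what it does not write to. -/
theorem Cmd.exec_phase {c : Cmd} (hc : c.Tame c.vars c.arrs) {m : State} {S L : ℕ}
    (hS : m.Bounded S) (hL : ∀ y ∈ c.bounds, m.var y ≤ L) :
    (∃ t, Exec c.toProg m (c.run m) t ∧
      t ≤ (c.weight.eval L * (c.weight.eval L + 1)) * (S + 1)) ∧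
    (c.run m).Bounded ((c.weight.eval L + 1) * (S + 1)) := by
  -- At the beginning of a phase all numbers have at most `S` digits, so `S` also serves as the
  -- bound `R` for the static ones.
  obtain ⟨⟨t, ht, hle⟩, h⟩ := c.exec_le hc (List.Subset.refl _) (List.Subset.refl _) m S
    ⟨fun x _ => hS.var x, fun a _ i => hS.arr a i⟩ hS hL
  exact ⟨⟨t, ht, hle.trans (le_of_eq (by ring))⟩, h.mono (by nlinarith)⟩

end Ram

/-! ## Scalar weights

The lexicographic order of bounded vectors is the order of the numbers with these digits. -/

/-- The number with the digits `a 0, …, a (q - 1)` in base `B`, the most significant first. -/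
def horner (B : ℕ) (a : ℕ → ℕ) : ℕ → ℕ
  | 0 => 0
  | q + 1 => horner B a q * B + a q

theorem horner_add (B : ℕ) (a b : ℕ → ℕ) (q : ℕ) :
    horner B (fun i => a i + b i) q = horner B a q + horner B b q := by
  induction q with
  | zero => rfl
  | succ q ih => simp only [horner, ih]; ring

theorem horner_zero (B q : ℕ) : horner B (fun _ => 0) q = 0 := by
  induction q with
  | zero => rfl
  | succ q ih => simp [horner, ih]

theorem horner_list_sum {α : Type*} (B : ℕ) (a : α → ℕ → ℕ) (l : List α) (q : ℕ) :
    (l.map fun e => horner B (a e) q).sum = horner B (fun i => (l.map fun e => a e i).sum) q := by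
  induction l with
  | nil => simp [horner_zero]
  | cons e l ih => simp [ih, horner_add]

theorem horner_congr {B : ℕ} {a b : ℕ → ℕ} {q : ℕ} (h : ∀ i < q, a i = b i) :
    horner B a q = horner B b q := by
  induction q with
  | zero => rfl
  | succ q ih => simp [horner, ih fun i hi => h i (by omega), h q (by omega)]

theorem horner_lt_pow {B : ℕ} {a : ℕ → ℕ} {q : ℕ} (h : ∀ i < q, a i < B) : horner B a q < B ^ q := by
  induction q with
  | zero => simp [horner]
  | succ q ih =>
    have h1 := ih fun i hi => h i (by omega)
    have h2 := h q (by omega)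
    simp only [horner, pow_succ]
    nlinarith

/-- The first difference is worth at least one unit of its place, which outweighs the later digits
of `a` because these are less than `B`. The digits of `b` need no bound. -/
theorem horner_lt_horner {B : ℕ} {a b : ℕ → ℕ} {q i : ℕ} (ha : ∀ i < q, a i < B) (hi : i < q)
    (h : ∀ j < i, a j = b j) (hlt : a i < b i) : horner B a q < horner B b q := by
  induction q with
  | zero => omega
  | succ q ih =>
    simp only [horner]
    rcases Nat.lt_succ_iff_lt_or_eq.1 hi with hi | rfl
    · have h1 := ih (fun i hi => ha i (by omega)) hi
      have h2 := ha q (by omega)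
      nlinarith
    · rw [horner_congr h]
      omega

/-! ## Codes of vertex sequences -/

/-- The `i`-th digit of `c` in base `n`, the least significant being the one with index `0`. -/
def digit (n c i : ℕ) : ℕ := c / n ^ i % n

/-- The number whose digits in base `n` are `f 0, …, f l`. -/
def code {n : ℕ} (f : ℕ → Fin n) (l : ℕ) : ℕ := ∑ i ∈ Finset.range (l + 1), (f i : ℕ) * n ^ i

theorem code_succ {n : ℕ} (f : ℕ → Fin n) (l : ℕ) :
    code f (l + 1) = code f l + (f (l + 1) : ℕ) * n ^ (l + 1) := by
  simp only [code, Finset.sum_range_succ]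

theorem code_lt {n : ℕ} (f : ℕ → Fin n) (l : ℕ) : code f l < n ^ (l + 1) := by
  induction l with
  | zero => simp [code]
  | succ l ih =>
    rw [code_succ, pow_succ n (l + 1)]
    have := (f (l + 1)).2
    nlinarith

theorem digit_code {n : ℕ} (f : ℕ → Fin n) {l i : ℕ} (hi : i ≤ l) :
    digit n (code f l) i = f i := by
  have hn : 0 < n := (f 0).pos
  induction l with
  | zero =>
    obtain rfl : i = 0 := by omega
    simp [digit, code, Nat.mod_eq_of_lt (f 0).2]
  | succ l ih =>
    rw [code_succ, digit]
    rcases Nat.le_succ_iff.1 hi with h | rfl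
    · rw [← ih h, digit]
      obtain ⟨d, rfl⟩ : ∃ d, l = i + d := ⟨l - i, by omega⟩
      rw [show (f (i + d + 1) : ℕ) * n ^ (i + d + 1) = n ^ i * (n * (f (i + d + 1) * n ^ d)) by ring,
        Nat.add_mul_div_left _ _ (pow_pos hn i), Nat.add_mul_mod_self_left]
    · rw [Nat.add_mul_div_right _ _ (pow_pos hn _), Nat.div_eq_of_lt (code_lt f l), zero_add,
        Nat.mod_eq_of_lt (f (l + 1)).2]

theorem code_congr {n : ℕ} {f g : ℕ → Fin n} {l : ℕ} (h : ∀ i ≤ l, f i = g i) :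
    code f l = code g l :=
  Finset.sum_congr rfl fun i hi => by rw [h i (by simp at hi; omega)]

theorem eq_of_code_eq {n : ℕ} {f g : ℕ → Fin n} {l : ℕ} (h : code f l = code g l) {i : ℕ}
    (hi : i ≤ l) : f i = g i := by
  apply Fin.ext
  rw [← digit_code f hi, h, digit_code g hi]

/-- The minimum of `b` and `f 0, …, f (i - 1)`. -/
def minUpTo (b : ℕ) (f : ℕ → ℕ) : ℕ → ℕ
  | 0 => b
  | i + 1 => min (minUpTo b f i) (f i)

theorem minUpTo_le {b : ℕ} {f : ℕ → ℕ} {n x : ℕ} (hx : x < n) : minUpTo b f n ≤ f x := by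
  induction n with
  | zero => omega
  | succ n ih =>
    rcases Nat.lt_succ_iff_lt_or_eq.1 hx with h | rfl
    · exact (min_le_left _ _).trans (ih h)
    · exact min_le_right _ _

theorem exists_eq_minUpTo {b : ℕ} {f : ℕ → ℕ} {n : ℕ} (h : minUpTo b f n < b) :
    ∃ x < n, minUpTo b f n = f x := by
  induction n with
  | zero => simp [minUpTo] at h
  | succ n ih =>
    rcases le_total (minUpTo b f n) (f n) with h' | h'
    · have e : minUpTo b f (n + 1) = minUpTo b f n := min_eq_left h'
      obtain ⟨x, hx, hx'⟩ := ih (e ▸ h)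
      exact ⟨x, by omega, e.trans hx'⟩
    · exact ⟨n, by omega, min_eq_right h'⟩

/-! ### Scalar weights of edges, arcs and walks. -/

namespace KPathsInstance

open SimpleGraph

variable (I : KPathsInstance)

/-- The base for scalar weights, a number greater than the weights of all simple paths. -/
noncomputable def base : ℕ := (I.encode.sum + 1) * I.n

/-- A number greater than the scalar weights of all simple paths. -/
noncomputable def inf : ℕ := I.base ^ I.q

/-- The weight of an edge with respect to criterion `i`. -/
def crit (e : Sym2 (Fin I.n)) (i : ℕ) : ℕ := if h : i < I.q then I.w e ⟨i, h⟩ else 0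

/-- The scalar weight of an edge. -/
noncomputable def edgeWeight (e : Sym2 (Fin I.n)) : ℕ := horner I.base (I.crit e) I.q

/-- The scalar weight of a walk. -/
noncomputable def walkWeight {I : KPathsInstance} {u v : Fin I.n} (p : I.G.Walk u v) : ℕ :=
  (p.edges.map I.edgeWeight).sum

open Classical in
/-- The scalar weights of the arcs of a digraph: the edges of the graph in both directions, except
that the destination has only a loop, of weight `0`. -/
noncomputable def arc (u v : Fin I.n) : ℕ :=
  if u = I.t then if v = I.t then 0 else I.inf
  else if I.G.Adj u v then I.edgeWeight s(u, v) else I.inf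

/-- The weights of arcs between vertices given by numbers. -/
noncomputable def arcN (u v : ℕ) : ℕ :=
  if h : u < I.n ∧ v < I.n then I.arc ⟨u, h.1⟩ ⟨v, h.2⟩ else 0

@[simp] theorem arcN_val (u v : Fin I.n) : I.arcN u v = I.arc u v := by
  simp [arcN]

theorem n_pos : 0 < I.n := I.s.pos

/-- Every weight of an edge is an entry of the encoding. The sum of the input is thus a bound for
the weights that a program can compute at once. -/
theorem crit_le_sum {u v : Fin I.n} (h : I.G.Adj u v) (i : ℕ) :
    I.crit s(u, v) i ≤ I.encode.sum := by
  unfold crit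
  split_ifs with hi
  · refine List.single_le_sum (by simp) _ ?_
    simp only [encode, List.mem_append, List.mem_flatMap]
    refine .inr ⟨u, List.mem_finRange u, v, List.mem_finRange v, ?_⟩
    rw [if_pos h]
    exact List.mem_cons_of_mem _ (List.mem_map.2 ⟨⟨i, hi⟩, List.mem_finRange _, rfl⟩)
  · exact Nat.zero_le _

/-- A simple path has fewer than `n` edges, each with weight at most the sum of the encoding; the `+
1` in `base` makes the inequality strict. -/
theorem sum_crit_lt (P : I.G.Path I.s I.t) (i : ℕ) :
    (P.1.edges.map fun e => I.crit e i).sum < I.base := by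
  have h1 : (P.1.edges.map fun e => I.crit e i).sum ≤
      (P.1.edges.map fun e => I.crit e i).length • I.encode.sum := by
    refine List.sum_le_card_nsmul _ _ fun x hx => ?_
    obtain ⟨e, he, rfl⟩ := List.mem_map.1 hx
    have := P.1.edges_subset_edgeSet he
    induction e with
    | _ u v => exact I.crit_le_sum this i
  have h2 : P.1.length < I.n := by simpa using P.2.length_lt
  rw [List.length_map, Walk.length_edges, smul_eq_mul] at h1
  have h3 := Nat.mul_le_mul_right I.encode.sum h2.le
  rw [base]
  nlinarith

theorem walkWeight_eq_horner {u v : Fin I.n} (p : I.G.Walk u v) :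
    walkWeight p = horner I.base (fun i => (p.edges.map fun e => I.crit e i).sum) I.q :=
  horner_list_sum _ _ _ _

theorem walkWeight_lt_inf (P : I.G.Path I.s I.t) : walkWeight P.1 < I.inf := by
  rw [walkWeight_eq_horner]
  exact horner_lt_pow fun i _ => I.sum_crit_lt P i

theorem walkWeight_lt_of_cost_lt {P Q : I.G.Path I.s I.t} (h : I.cost P < I.cost Q) :
    walkWeight P.1 < walkWeight Q.1 := by
  obtain ⟨i, hj, hi⟩ := h
  rw [walkWeight_eq_horner, walkWeight_eq_horner]
  refine horner_lt_horner (fun i _ => I.sum_crit_lt P i) i.2 (fun j hji => ?_) ?_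
  · have := hj ⟨j, hji.trans i.2⟩ hji
    simpa [crit, hji.trans i.2, cost] using this
  · simpa [crit, cost] using hi

/-- The lexicographic order is total, so strict monotonicity of the scalar weight suffices. -/
theorem cost_le_of_walkWeight_le {P Q : I.G.Path I.s I.t}
    (h : walkWeight P.1 ≤ walkWeight Q.1) : I.cost P ≤ I.cost Q :=
  not_lt.1 fun h' => (I.walkWeight_lt_of_cost_lt h').not_ge h

/-! ## Shortest completions of a prefix -/

open Classical in
/-- The least weight of a walk with `j` arcs from `v` to the destination outside `V`. -/
noncomputable def dist (V : ℕ → Prop) : ℕ → ℕ → ℕ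
  | 0, v => if v = I.t then 0 else I.inf
  | j + 1, v => if V v then I.inf else minUpTo I.inf (fun x => I.arcN v x + dist V j x) I.n

/-- The vertex `v` is one of the first `l` vertices of the sequence with code `c`, but not the
destination. -/
def Visited (c l v : ℕ) : Prop := v ≠ I.t ∧ ∃ i < l, digit I.n c i = v

/-- The least weight of a path that extends the sequence with code `c` and last index `l`. -/
noncomputable def key (c l : ℕ) : ℕ :=
  ∑ i ∈ Finset.range l, I.arcN (digit I.n c i) (digit I.n c (i + 1)) +
    I.dist (I.Visited c l) I.n (digit I.n c l)

theorem visited_code (f : ℕ → Fin I.n) (l : ℕ) (v : Fin I.n) :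
    I.Visited (code f l) l v ↔ v ≠ I.t ∧ ∃ i < l, f i = v := by
  unfold Visited
  refine and_congr (by simp [Fin.ext_iff]) (exists_congr fun i => and_congr_right fun hi => ?_)
  rw [digit_code f hi.le, Fin.ext_iff]

theorem key_code (f : ℕ → Fin I.n) (l : ℕ) :
    I.key (code f l) l = ∑ i ∈ Finset.range l, I.arc (f i) (f (i + 1)) +
      I.dist (I.Visited (code f l) l) I.n (f l) := by
  unfold key
  rw [digit_code f le_rfl]
  congr 1
  refine Finset.sum_congr rfl fun i hi => ?_
  have hi := Finset.mem_range.1 hi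
  rw [digit_code f hi.le, digit_code f hi, arcN_val]

/-- A path meets `t` only at its end, so its arcs are edges leaving other vertices; past its length
`getVert` stays at `t`, where the loop has weight `0`. -/
theorem walkWeight_eq_sum_arc {I : KPathsInstance} {u v : Fin I.n} (p : I.G.Walk u v)
    (hv : v = I.t) (hp : p.IsPath) {N : ℕ} (hN : p.length ≤ N) :
    walkWeight p = ∑ i ∈ Finset.range N, I.arc (p.getVert i) (p.getVert (i + 1)) := by
  induction p generalizing N with
  | nil => simp [walkWeight, arc, hv]
  | @cons u x v h p ih =>
    obtain ⟨N, rfl⟩ : ∃ M, N = M + 1 := ⟨N - 1, by simp at hN; omega⟩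
    rw [Walk.cons_isPath_iff] at hp
    rw [Finset.sum_range_succ']
    have hu : u ≠ I.t := fun e => hp.2 (by rw [e, ← hv]; exact p.end_mem_support)
    have := ih hv hp.1 (N := N) (by simpa using hN)
    simp only [walkWeight, Walk.edges_cons, List.map_cons, List.sum_cons] at this ⊢
    have harc : I.arc u x = I.edgeWeight s(u, x) := by simp [arc, hu, h]
    rw [this, add_comm]
    simp [harc]

/-- The sequence `f` competes in each of the minima that define `dist`. It has to be at `t` after
exactly `j` arcs, which padding achieves. -/
theorem dist_le_sum_arc (V : ℕ → Prop) (f : ℕ → Fin I.n) {m j : ℕ} (hj : f (m + j) = I.t)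
    (hV : ∀ i, m ≤ i → ¬ V (f i)) :
    I.dist V j (f m) ≤ ∑ i ∈ Finset.range j, I.arc (f (m + i)) (f (m + i + 1)) := by
  induction j generalizing m with
  | zero => rw [add_zero] at hj; simp [dist, hj]
  | succ j ih =>
    rw [dist, if_neg (hV m le_rfl), Finset.sum_range_succ']
    refine (minUpTo_le (f (m + 1)).2).trans ?_
    rw [arcN_val, add_comm]
    refine Nat.add_le_add ?_ le_rfl
    refine (ih (m := m + 1) (by rw [← hj]; congr 1; omega) fun i hi => hV i (by omega)).trans ?_
    refine le_of_eq (Finset.sum_congr rfl fun i _ => ?_)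
    rw [show m + 1 + i = m + (i + 1) by omega]

/-- A path is injective on the indices up to its length, so a repetition comes from the constant
tail of `getVert`. -/
theorem eq_t_of_getVert_eq (P : I.G.Path I.s I.t) {i j : ℕ} (hij : i < j)
    (h : P.1.getVert i = P.1.getVert j) : P.1.getVert i = I.t := by
  by_contra hne
  have hi : i < P.1.length := by
    by_contra h'
    exact hne (P.1.getVert_of_length_le (by omega))
  have hj : j < P.1.length := by
    by_contra h'
    exact hne (h.trans (P.1.getVert_of_length_le (by omega)))
  exact hij.ne (P.2.getVert_injOn hi.le hj.le h)

theorem length_lt_n (P : I.G.Path I.s I.t) : P.1.length < I.n := by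
  simpa using P.2.length_lt

/-- The key of a prefix of a path is at most the weight of the path. -/
theorem key_le_walkWeight (P : I.G.Path I.s I.t) (l : ℕ) :
    I.key (code P.1.getVert l) l ≤ walkWeight P.1 := by
  have hlen := I.length_lt_n P
  -- Padding allows any number of arcs from the length on; `l + n` leaves exactly the `n` arcs that
  -- `key` admits after the prefix.
  rw [key_code, walkWeight_eq_sum_arc P.1 rfl P.2 (N := l + I.n) (by omega), Finset.sum_range_add]
  refine Nat.add_le_add_left (I.dist_le_sum_arc _ _ (P.1.getVert_of_length_le (by omega)) ?_) _
  intro i hi hV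
  rw [visited_code] at hV
  obtain ⟨hne, j, hj, hji⟩ := hV
  exact hne (hji ▸ I.eq_t_of_getVert_eq P (by omega) hji)

/-- A value below `inf` is attained in each minimum. The arc attaining it is an edge if it leaves a
vertex other than `t`, since the other arcs there have weight `inf`. At `t` the walk stops, however
many arcs are left. -/
theorem exists_walk_of_dist_lt {V : ℕ → Prop} (hV : ¬ V I.t) (j : ℕ) (u : Fin I.n)
    (h : I.dist V j u < I.inf) :
    ∃ p : I.G.Walk u I.t, (∀ x ∈ p.support, ¬ V x) ∧ walkWeight p ≤ I.dist V j u := by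
  by_cases hu : u = I.t
  · subst hu
    exact ⟨.nil, by simpa using hV, by simp [walkWeight]⟩
  induction j generalizing u with
  | zero => simp [dist, Fin.val_inj, hu] at h
  | succ j ih =>
    rw [dist] at h ⊢
    split_ifs at h ⊢ with hVu
    · exact absurd h (lt_irrefl _)
    obtain ⟨x, hx, e⟩ := exists_eq_minUpTo h
    rw [e] at h ⊢
    lift x to Fin I.n using hx
    rw [arcN_val] at h ⊢
    have hadj : I.G.Adj u x := by
      by_contra hadj
      simp [arc, hu, hadj] at h
    obtain ⟨p, hp, hle⟩ : ∃ p : I.G.Walk x I.t, (∀ y ∈ p.support, ¬ V y) ∧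
        walkWeight p ≤ I.dist V j x := by
      by_cases hx : x = I.t
      · subst hx
        exact ⟨.nil, by simpa using hV, by simp [walkWeight]⟩
      · exact ih x (by omega) hx
    refine ⟨.cons hadj p, by simpa using ⟨hVu, hp⟩, ?_⟩
    have : I.arc u x = I.edgeWeight s(u, x) := by simp [arc, hu, hadj]
    simp only [walkWeight, Walk.edges_cons, List.map_cons, List.sum_cons] at hle ⊢
    omega

/-- A prefix whose key is finite extends to a path whose weight is at most the key. -/
theorem exists_path_of_key_lt (f : ℕ → Fin I.n) (l : ℕ) (h0 : f 0 = I.s)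
    (hf : ∀ i j, i < j → j < l → f i = f j → f i = I.t) (h : I.key (code f l) l < I.inf) :
    ∃ P : I.G.Path I.s I.t, (∀ i ≤ l, P.1.getVert i = f i) ∧
      walkWeight P.1 ≤ I.key (code f l) l := by
  rw [key_code] at h ⊢
  set V := I.Visited (code f l) l
  have hVf : ∀ v : Fin I.n, V v ↔ v ≠ I.t ∧ ∃ i < l, f i = v := I.visited_code f l
  set d := I.dist V I.n (f l) with hd
  -- The path is built from its end backwards: `p` starts at position `a` of the prefix and has `j`
  -- more prescribed vertices. The third condition, that `p` avoids the earlier vertices other than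
  -- `t`, keeps it a path when a vertex is prepended.
  have main : ∀ j a, a + j = l → ∃ p : I.G.Walk (f a) I.t, p.IsPath ∧
      (∀ i ≤ j, p.getVert i = f (a + i)) ∧ (∀ i < a, f i ∈ p.support → f i = I.t) ∧
      walkWeight p ≤ ∑ i ∈ Finset.Ico a l, I.arc (f i) (f (i + 1)) + d := by
    intro j
    induction j with
    | zero =>
      rintro a rfl
      obtain ⟨p, hp, hle⟩ := I.exists_walk_of_dist_lt (V := V) (by rw [hVf]; simp) I.n (f a)
        (by simp only [add_zero] at hd; omega)
      -- Cutting out cycles does not increase the weight and only shrinks the set of vertices.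
      refine ⟨p.bypass, p.bypass_isPath, by simp, fun i hi hs => ?_, ?_⟩
      · by_contra hne
        exact hp _ (p.support_bypass_subset_support hs) ((hVf _).2 ⟨hne, i, by omega, rfl⟩)
      · have := ((p.edges_bypass_sublist_edges).map I.edgeWeight).sum_le_sum (by simp)
        simp only [walkWeight, add_zero, Finset.Ico_self, Finset.sum_empty] at hle hd ⊢
        omega
    | succ j ih =>
      intro a hj
      obtain ⟨p, hp, hv, hs, hw⟩ := ih (a + 1) (by omega)
      have harc : I.arc (f a) (f (a + 1)) < I.inf :=
        (Finset.single_le_sum (f := fun i => I.arc (f i) (f (i + 1))) (fun _ _ => Nat.zero_le _)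
          (Finset.mem_range.2 (show a < l by omega))).trans_lt (by omega)
      rw [Finset.sum_eq_sum_Ico_succ_bot (by omega)]
      -- A prefix of finite key that has reached `t` stays there, because an arc from `t` to another
      -- vertex has weight `inf`.
      by_cases hfa : f a = I.t
      · have hfa' : f (a + 1) = I.t := by
          by_contra hne
          simp [arc, hfa, hne] at harc
        refine ⟨Walk.nil.copy hfa.symm rfl, by simp, fun i hi => ?_, fun i hi hs => ?_, by
          simp [walkWeight]⟩
        · rw [Walk.getVert_copy, Walk.getVert_nil]
          cases i with
          | zero => exact hfa.symm
          | succ i =>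
            rw [show a + (i + 1) = a + 1 + i by omega, ← hv i (by omega)]
            -- The remaining path leads from `t` to `t`, so it is empty.
            clear hv hs hw
            revert p
            rw [hfa']
            intro p hp
            rw [(Walk.isPath_iff_nil.1 hp).eq_nil, Walk.getVert_nil]
        · simpa using hs
      · have hadj : I.G.Adj (f a) (f (a + 1)) := by
          by_contra hadj
          simp [arc, hfa, hadj] at harc
        refine ⟨.cons hadj p, ?_, fun i hi => ?_, fun i hi hs' => ?_, ?_⟩
        · exact (Walk.cons_isPath_iff _ _).2 ⟨hp, fun hm => hfa (hs a (by omega) hm)⟩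
        · cases i with
          | zero => simp
          | succ i =>
            rw [Walk.getVert_cons_succ, hv i (by omega), show a + 1 + i = a + (i + 1) by omega]
        · rw [Walk.support_cons, List.mem_cons] at hs'
          rcases hs' with e | hm
          · exact hf i a hi (by omega) e
          · exact hs i (by omega) hm
        · have : I.arc (f a) (f (a + 1)) = I.edgeWeight s(f a, f (a + 1)) := by
            simp [arc, hfa, hadj]
          simp only [walkWeight, Walk.edges_cons, List.map_cons, List.sum_cons] at hw ⊢
          omega
  obtain ⟨p, hp, hv, -, hw⟩ := main l 0 (by omega)
  refine ⟨⟨p.copy h0 rfl, by simpa using hp⟩, fun i hi => ?_, ?_⟩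
  · simpa using hv i hi
  · simpa [walkWeight] using hw

/-- Paths are determined by their codes. -/
theorem path_eq_of_code_eq {P Q : I.G.Path I.s I.t}
    (h : code P.1.getVert I.n = code Q.1.getVert I.n) : P = Q := by
  apply Subtype.ext
  apply Walk.ext_getVert
  intro i
  have hP := I.length_lt_n P
  have hQ := I.length_lt_n Q
  rcases le_total i I.n with hi | hi
  · exact eq_of_code_eq h hi
  · rw [P.1.getVert_of_length_le (by omega), Q.1.getVert_of_length_le (by omega)]

end KPathsInstance

/-! ## Selection of the smallest numbers -/

/-- The numbers `A 0 < … < A (r - 1)` are the `k` smallest ones with the property `S`, or all of them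
if there are fewer than `k`. -/
structure IsSelection (k : ℕ) (S : ℕ → Prop) (A : ℕ → ℕ) (r : ℕ) : Prop where
  le : r ≤ k
  sorted : ∀ i j, i < j → j < r → A i < A j
  mem : ∀ i < r, S (A i)
  cover : ∀ y, S y → (∃ i < r, A i = y) ∨ (r = k ∧ ∀ i < r, A i < y)

theorem IsSelection.congr {k : ℕ} {S S' : ℕ → Prop} {A A' : ℕ → ℕ} {r : ℕ}
    (h : IsSelection k S A r) (hS : ∀ y, S y ↔ S' y) (hA : ∀ i < r, A' i = A i) :
    IsSelection k S' A' r where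
  le := h.le
  sorted i j hij hj := by rw [hA i (by omega), hA j hj]; exact h.sorted i j hij hj
  mem i hi := by rw [hA i hi]; exact (hS _).1 (h.mem i hi)
  cover y hy := by
    rcases h.cover y ((hS y).2 hy) with ⟨i, hi, e⟩ | ⟨e, hlt⟩
    · exact .inl ⟨i, hi, (hA i hi).trans e⟩
    · exact .inr ⟨e, fun i hi => (hA i hi).trans_lt (hlt i hi)⟩

theorem isSelection_empty (k : ℕ) {S : ℕ → Prop} (hS : ∀ y, ¬ S y) (A : ℕ → ℕ) :
    IsSelection k S A 0 where
  le := Nat.zero_le _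
  sorted i j _ hj := by omega
  mem i hi := by omega
  cover y hy := (hS y hy).elim

/-- An intermediate state of the insertion of `x` into the sorted list `A 0, …, A (r - 1)`: the list
has become `B 0, …, B (r - 1)`, the number `z` remains to be inserted, after position `i`. -/
structure IsInsertion (A : ℕ → ℕ) (r x i : ℕ) (B : ℕ → ℕ) (z : ℕ) : Prop where
  sorted : ∀ i j, i < j → j < r → B i < B j
  lt : ∀ j < i, j < r → B j < z
  mem : ∀ y, (y = z ∨ ∃ j < r, B j = y) ↔ (y = x ∨ ∃ j < r, A j = y)
  ne : ∀ j < r, B j ≠ z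

theorem IsSelection.isInsertion {k : ℕ} {S : ℕ → Prop} {A : ℕ → ℕ} {r x : ℕ}
    (h : IsSelection k S A r) (hx : ¬ S x) : IsInsertion A r x 0 A x where
  sorted := h.sorted
  lt j hj := by omega
  mem _ := Iff.rfl
  ne j hj e := hx (e ▸ h.mem j hj)

theorem IsInsertion.skip {A : ℕ → ℕ} {r x i : ℕ} {B : ℕ → ℕ} {z : ℕ} (h : IsInsertion A r x i B z)
    (hz : i < r → B i ≤ z) : IsInsertion A r x (i + 1) B z where
  sorted := h.sorted
  lt j hj hr := by
    rcases Nat.lt_succ_iff_lt_or_eq.1 hj with hj | rfl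
    · exact h.lt j hj hr
    · exact lt_of_le_of_ne (hz hr) (h.ne j hr)
  mem := h.mem
  ne := h.ne

/-- The entry `B i` gives way to `z` and becomes the number to be inserted: it exceeds `z` and hence
everything up to position `i`. -/
theorem IsInsertion.swap {A : ℕ → ℕ} {r x i : ℕ} {B B' : ℕ → ℕ} {z : ℕ}
    (h : IsInsertion A r x i B z) (hi : i < r) (hz : z < B i) (hB : B' i = z)
    (hB' : ∀ j < r, j ≠ i → B' j = B j) : IsInsertion A r x (i + 1) B' (B i) where
  sorted a b hab hb := by
    by_cases ha : a = i
    · subst ha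
      rw [hB, hB' b hb (by omega)]
      exact hz.trans (h.sorted a b hab hb)
    · rw [hB' a (by omega) ha]
      by_cases hb' : b = i
      · subst hb'
        rw [hB]
        exact h.lt a hab (by omega)
      · rw [hB' b hb hb']
        exact h.sorted a b hab hb
  lt j hj hr := by
    by_cases hji : j = i
    · rw [hji, hB]
      exact hz
    · rw [hB' j hr hji]
      exact h.sorted j i (by omega) hi
  mem y := by
    rw [← h.mem y]
    constructor
    · rintro (rfl | ⟨j, hj, rfl⟩)
      · exact .inr ⟨i, hi, rfl⟩
      · by_cases hji : j = i
        · exact .inl (hji ▸ hB)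
        · exact .inr ⟨j, hj, (hB' j hj hji).symm⟩
    · rintro (rfl | ⟨j, hj, rfl⟩)
      · exact .inr ⟨i, hi, hB⟩
      · by_cases hji : j = i
        · exact .inl (by rw [hji])
        · exact .inr ⟨j, hj, hB' j hj hji⟩
  ne j hj := by
    by_cases hji : j = i
    · rw [hji, hB]
      exact hz.ne
    · rw [hB' j hj hji]
      rcases Nat.lt_or_gt_of_ne hji with h' | h'
      · exact (h.sorted j i h' hi).ne
      · exact (h.sorted i j h' hj).ne'

/-- The number left over after the last position is the largest of the `k + 1` numbers, so it is the
one to drop. -/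
theorem IsSelection.insert_of_eq {k : ℕ} {S : ℕ → Prop} {A : ℕ → ℕ} {x i : ℕ} {B : ℕ → ℕ}
    {z : ℕ} (h : IsSelection k S A k) (hi : IsInsertion A k x i B z) (hki : k ≤ i) :
    IsSelection k (fun y => S y ∨ y = x) B k where
  le := le_rfl
  sorted := hi.sorted
  mem j hj := by
    rcases (hi.mem (B j)).1 (.inr ⟨j, hj, rfl⟩) with e | ⟨a, ha, e⟩
    · exact .inr e
    · exact .inl (e ▸ h.mem a ha)
  cover y hy := by
    have key : (y = z ∨ ∃ j < k, B j = y) →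
        (∃ j < k, B j = y) ∨ (k = k ∧ ∀ j < k, B j < y) := by
      rintro (rfl | h')
      · exact .inr ⟨rfl, fun j hj => hi.lt j (by omega) hj⟩
      · exact .inl h'
    rcases hy with hy | rfl
    · rcases h.cover y hy with h' | ⟨-, h'⟩
      · exact key ((hi.mem y).2 (.inr h'))
      · refine .inr ⟨rfl, fun j hj => ?_⟩
        rcases (hi.mem (B j)).1 (.inr ⟨j, hj, rfl⟩) with e | ⟨a, ha, e⟩
        -- If the entry is `x` itself, the number left over is an old entry, which lies above `x`
        -- and below `y`.
        · rcases (hi.mem z).1 (.inl rfl) with e' | ⟨b, hb, e'⟩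
          · exact (hi.ne j hj (e.trans e'.symm)).elim
          · exact (hi.lt j (by omega) hj).trans (e' ▸ h' b hb)
        · exact e ▸ h' a ha
    · exact key ((hi.mem y).2 (.inl rfl))

/-- A selection that is not full contains every number with the property, so nothing is dropped and
the number left over goes to the end. -/
theorem IsSelection.insert_of_lt {k r : ℕ} {S : ℕ → Prop} {A : ℕ → ℕ} {x i : ℕ} {B B' : ℕ → ℕ}
    {z : ℕ} (h : IsSelection k S A r) (hi : IsInsertion A r x i B z) (hri : r ≤ i) (hrk : r < k)
    (hB : ∀ j < r, B' j = B j) (hr : B' r = z) :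
    IsSelection k (fun y => S y ∨ y = x) B' (r + 1) where
  le := hrk
  sorted a b hab hb := by
    rcases Nat.lt_succ_iff_lt_or_eq.1 hb with hb | rfl
    · rw [hB a (by omega), hB b hb]
      exact hi.sorted a b hab hb
    · rw [hB a hab, hr]
      exact hi.lt a (by omega) hab
  mem j hj := by
    have : B' j = z ∨ ∃ a < r, B a = B' j := by
      rcases Nat.lt_succ_iff_lt_or_eq.1 hj with hj | rfl
      · exact .inr ⟨j, hj, (hB j hj).symm⟩
      · exact .inl hr
    rcases (hi.mem (B' j)).1 this with e | ⟨a, ha, e⟩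
    · exact .inr e
    · exact .inl (e ▸ h.mem a ha)
  cover y hy := by
    left
    have : y = x ∨ ∃ j < r, A j = y := by
      rcases hy with hy | hy
      · rcases h.cover y hy with h' | ⟨h', -⟩
        · exact .inr h'
        · omega
      · exact .inl hy
    rcases (hi.mem y).2 this with rfl | ⟨j, hj, rfl⟩
    · exact ⟨r, by omega, hr⟩
    · exact ⟨j, by omega, hB j hj⟩

namespace KPathsInstance

open SimpleGraph

variable (I : KPathsInstance)

/-! ## Beam search -/

/-- A number that exceeds all codes. -/
def codeBound : ℕ := I.n ^ (I.n + 1)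

/-- The key and the code of a prefix, combined into one number. -/
noncomputable def rank (l c : ℕ) : ℕ := I.key c l * I.codeBound + c

/-- The ranks of those one-vertex extensions of the prefixes with codes `A 0, …, A (r - 1)` that have
a finite key and precede the extension of `A i` by `v`. -/
def IsCandidate (l : ℕ) (A : ℕ → ℕ) (r i v y : ℕ) : Prop :=
  ∃ i' v', (i' < i ∨ i' = i ∧ v' < v) ∧ i' < r ∧ v' < I.n ∧
    I.key (A i' + v' * I.n ^ (l + 1)) (l + 1) < I.inf ∧
    y = I.rank (l + 1) (A i' + v' * I.n ^ (l + 1))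

/-- The prefixes with last index `l` and codes `A 0, …, A (r - 1)` are such that the paths that
extend them include a solution. -/
structure IsBeam (l : ℕ) (A : ℕ → ℕ) (r : ℕ) : Prop where
  le : r ≤ I.k
  sorted : ∀ i j, i < j → j < r → I.rank l (A i) < I.rank l (A j)
  isPrefix : ∀ i < r, ∃ f : ℕ → Fin I.n, f 0 = I.s ∧
    (∀ a b, a < b → b ≤ l → f a = f b → f a = I.t) ∧ A i = code f l
  finite : 0 < l → ∀ i < r, I.key (A i) l < I.inf
  cover : ∀ P : I.G.Path I.s I.t, (∃ i < r, A i = code P.1.getVert l) ∨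
    (r = I.k ∧ ∀ i < r, I.key (A i) l ≤ walkWeight P.1)

variable {I}

theorem rank_mod {l c : ℕ} (hc : c < I.codeBound) : I.rank l c % I.codeBound = c := by
  rw [rank, Nat.mul_add_mod_self_right, Nat.mod_eq_of_lt hc]

theorem rank_div {l c : ℕ} (hc : c < I.codeBound) : I.rank l c / I.codeBound = I.key c l := by
  rw [rank, mul_comm, Nat.mul_add_div (by omega), Nat.div_eq_of_lt hc, add_zero]

theorem code_lt_codeBound (f : ℕ → Fin I.n) {l : ℕ} (hl : l ≤ I.n) : code f l < I.codeBound :=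
  (code_lt f l).trans_le (Nat.pow_le_pow_right I.n_pos (by omega))

theorem key_le_key_of_rank_lt {l c d : ℕ} (hc : c < I.codeBound) (hd : d < I.codeBound)
    (h : I.rank l c < I.rank l d) : I.key c l ≤ I.key d l := by
  rw [← rank_div hc, ← rank_div hd]
  exact Nat.div_le_div_right h.le

/-- All paths share the prefix `s`; for `k = 0` the empty beam counts as full. Finite keys are
demanded only from level `1` on, since the key of the initial prefix is not tested. -/
theorem isBeam_zero {A : ℕ → ℕ} {r : ℕ} (hr : r = min 1 I.k) (hA : A 0 = I.s) : I.IsBeam 0 A r where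
  le := by omega
  sorted i j _ _ := by omega
  isPrefix i hi := by
    obtain rfl : i = 0 := by omega
    exact ⟨fun _ => I.s, rfl, fun a b _ _ => by omega, by simp [code, hA]⟩
  finite h := absurd h (lt_irrefl _)
  cover P := by
    rcases Nat.eq_zero_or_pos I.k with h | h
    · exact .inr ⟨by omega, fun i hi => by omega⟩
    · exact .inl ⟨0, by omega, by simp [code, hA]⟩

namespace IsBeam

variable {l r : ℕ} {A : ℕ → ℕ}

/-- The code of an extension of a prefix in the beam. -/
theorem exists_code_eq (h : I.IsBeam l A r) {i v : ℕ} (hi : i < r) (hv : v < I.n) :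
    ∃ f : ℕ → Fin I.n, f 0 = I.s ∧ (∀ a b, a < b → b < l + 1 → f a = f b → f a = I.t) ∧
      A i = code f l ∧ A i + v * I.n ^ (l + 1) = code f (l + 1) := by
  obtain ⟨f, h0, hf, e⟩ := h.isPrefix i hi
  let g : ℕ → Fin I.n := fun j => if j ≤ l then f j else ⟨v, hv⟩
  have hg : ∀ j ≤ l, g j = f j := fun j hj => if_pos hj
  have e' : A i = code g l := e.trans (code_congr fun j hj => (hg j hj).symm)
  refine ⟨g, (hg 0 (Nat.zero_le _)).trans h0, fun a b hab hb => ?_, e', ?_⟩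
  · rw [hg a (by omega), hg b (by omega)]
    exact hf a b hab (by omega)
  · rw [code_succ, ← e']
    simp [g]

theorem injective (h : I.IsBeam l A r) {i j : ℕ} (hi : i < r) (hj : j < r) (e : A i = A j) :
    i = j := by
  rcases lt_trichotomy i j with h' | h' | h'
  · exact absurd (h.sorted i j h' hj) (by rw [e]; exact lt_irrefl _)
  · exact h'
  · exact absurd (h.sorted j i h' hi) (by rw [e]; exact lt_irrefl _)

/-- The codes of the prefixes are less than `n ^ (l + 1)`, so the new vertex can be read off as the
leading digit. -/
theorem ext_injective (h : I.IsBeam l A r) {i j v w : ℕ} (hi : i < r) (hj : j < r) (hv : v < I.n)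
    (hw : w < I.n) (e : A i + v * I.n ^ (l + 1) = A j + w * I.n ^ (l + 1)) : i = j ∧ v = w := by
  obtain ⟨f, -, -, hf, -⟩ := h.exists_code_eq hi hv
  obtain ⟨g, -, -, hg, -⟩ := h.exists_code_eq hj hw
  have h1 : A i < I.n ^ (l + 1) := hf ▸ code_lt f l
  have h2 : A j < I.n ^ (l + 1) := hg ▸ code_lt g l
  have e1 : A i = A j := by
    have := congrArg (· % I.n ^ (l + 1)) e
    simpa [Nat.add_mul_mod_self_right, Nat.mod_eq_of_lt h1, Nat.mod_eq_of_lt h2] using this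
  refine ⟨h.injective hi hj e1, ?_⟩
  rw [e1] at e
  exact Nat.eq_of_mul_eq_mul_right (by omega) (Nat.add_left_cancel e)

theorem ext_lt (h : I.IsBeam l A r) (hl : l < I.n) {i v : ℕ} (hi : i < r) (hv : v < I.n) :
    A i + v * I.n ^ (l + 1) < I.codeBound := by
  obtain ⟨f, -, -, -, hf⟩ := h.exists_code_eq hi hv
  exact hf ▸ code_lt_codeBound f hl

/-- Insertion needs a number that is not yet present. The code contained in the rank separates
extensions with equal keys. -/
theorem not_isCandidate_self (h : I.IsBeam l A r) (hl : l < I.n) {i v : ℕ} (hi : i < r)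
    (hv : v < I.n) :
    ¬ I.IsCandidate l A r i v (I.rank (l + 1) (A i + v * I.n ^ (l + 1))) := by
  rintro ⟨j, w, hlt, hj, hw, -, e⟩
  have e' := congrArg (· % I.codeBound) e
  simp only [rank_mod (h.ext_lt hl hi hv), rank_mod (h.ext_lt hl hj hw)] at e'
  have := h.ext_injective hi hj hv hw e'
  omega

/-- The passage from one level to the next. -/
theorem succ (h : I.IsBeam l A r) (hl : l < I.n) {B : ℕ → ℕ} {r' : ℕ}
    (hB : IsSelection I.k (I.IsCandidate l A r I.k 0) B r') :
    I.IsBeam (l + 1) (fun i => B i % I.codeBound) r' := by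
  have hcand : ∀ y, I.IsCandidate l A r I.k 0 y → ∃ i v, i < r ∧ v < I.n ∧
      y % I.codeBound = A i + v * I.n ^ (l + 1) ∧ y % I.codeBound < I.codeBound ∧
      I.key (y % I.codeBound) (l + 1) < I.inf ∧ y = I.rank (l + 1) (y % I.codeBound) := by
    rintro y ⟨i, v, -, hi, hv, hk, e⟩
    have h1 := h.ext_lt hl hi hv
    have h2 : y % I.codeBound = A i + v * I.n ^ (l + 1) := by rw [e, rank_mod h1]
    exact ⟨i, v, hi, hv, h2, h2 ▸ h1, h2 ▸ hk, h2 ▸ e⟩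
  have hmem : ∀ P : I.G.Path I.s I.t, (∃ i < r, A i = code P.1.getVert l) →
      I.IsCandidate l A r I.k 0 (I.rank (l + 1) (code P.1.getVert (l + 1))) := by
    rintro P ⟨i, hi, e⟩
    have := code_succ P.1.getVert l
    rw [← e] at this
    refine ⟨i, P.1.getVert (l + 1), .inl (hi.trans_le h.le), hi, (P.1.getVert (l + 1)).2, ?_, ?_⟩
    · rw [← this]
      exact (I.key_le_walkWeight P _).trans_lt (I.walkWeight_lt_inf P)
    · rw [← this]
  -- Ranks compare keys first, and the key of a prefix of `P` is at most the weight of `P`.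
  have hlt : ∀ P : I.G.Path I.s I.t, ∀ i < r',
      B i ≤ I.rank (l + 1) (code P.1.getVert (l + 1)) →
      I.key (B i % I.codeBound) (l + 1) ≤ walkWeight P.1 := by
    intro P i hi hle
    obtain ⟨-, -, -, -, -, h1, -, h2⟩ := hcand _ (hB.mem i hi)
    refine le_trans ?_ (I.key_le_walkWeight P (l + 1))
    rw [← rank_div h1, ← h2, ← rank_div (code_lt_codeBound P.1.getVert hl)]
    exact Nat.div_le_div_right hle
  refine ⟨hB.le, fun i j hij hj => ?_, fun i hi => ?_, fun _ i hi => ?_, fun P => ?_⟩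
  · obtain ⟨-, -, -, -, -, -, -, e1⟩ := hcand _ (hB.mem i (hij.trans hj))
    obtain ⟨-, -, -, -, -, -, -, e2⟩ := hcand _ (hB.mem j hj)
    rw [← e1, ← e2]
    exact hB.sorted i j hij hj
  · obtain ⟨a, v, ha, hv, e, -, hk, -⟩ := hcand _ (hB.mem i hi)
    obtain ⟨f, h0, hf, -, e'⟩ := h.exists_code_eq ha hv
    rw [e, e'] at hk
    -- The appended vertex might repeat an earlier one. A finite key excludes this, because the
    -- extended prefix then belongs to a path.
    obtain ⟨P, hP, -⟩ := I.exists_path_of_key_lt f (l + 1) h0 hf hk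
    refine ⟨P.1.getVert, by simp, fun a b hab _ => I.eq_t_of_getVert_eq P hab, ?_⟩
    exact (e.trans e').trans (code_congr fun j hj => (hP j hj).symm)
  · obtain ⟨-, -, -, -, -, -, hk, -⟩ := hcand _ (hB.mem i hi)
    exact hk
  · rcases h.cover P with h' | ⟨rfl, h'⟩
    · rcases hB.cover _ (hmem P h') with ⟨i, hi, e⟩ | ⟨e, h''⟩
      · exact .inl ⟨i, hi, by simp only [e]; exact rank_mod (code_lt_codeBound _ hl)⟩
      · exact .inr ⟨e, fun i hi => hlt P i hi (h'' i hi).le⟩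
    -- Here the prefix of `P` need not be in the beam, but the beam is full. Its `k` prefixes have
    -- completions `Q i` that are no heavier than `P`, and each of these yields a candidate for the
    -- next level.
    · have hQ : ∀ i < I.k, ∃ Q : I.G.Path I.s I.t, A i = code Q.1.getVert l ∧
          walkWeight Q.1 ≤ walkWeight P.1 := by
        intro i hi
        obtain ⟨f, h0, hf, e⟩ := h.isPrefix i hi
        have hk := h' i hi
        rw [e] at hk
        obtain ⟨Q, hQ, hw⟩ := I.exists_path_of_key_lt f l h0
          (fun a b hab hb => hf a b hab hb.le) (hk.trans_lt (I.walkWeight_lt_inf P))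
        exact ⟨Q, e.trans (code_congr fun j hj => (hQ j hj).symm), hw.trans hk⟩
      have : Nonempty (I.G.Path I.s I.t) := ⟨P⟩
      choose! Q hQA hQw using hQ
      right
      -- If all these candidates are selected, they fill the selection by counting, so every key in
      -- it is at most the weight of some `Q i`. If one is missing, the selection is full and
      -- consists of smaller ranks.
      by_cases hall : ∀ i < I.k, ∃ j < r', B j = I.rank (l + 1) (code (Q i).1.getVert (l + 1))
      · choose! g hg hBg using hall
        have hinj : ∀ i < I.k, ∀ j < I.k, g i = g j → i = j := by
          intro i hi j hj e
          have e1 := hBg i hi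
          rw [e, hBg j hj] at e1
          have e2 := congrArg (· % I.codeBound) e1
          simp only [rank_mod (code_lt_codeBound _ hl)] at e2
          refine h.injective hi hj ?_
          rw [hQA i hi, hQA j hj]
          exact code_congr fun a ha => eq_of_code_eq e2.symm (by omega)
        have himg : (Finset.range I.k).image g ⊆ Finset.range r' := by
          intro x hx
          obtain ⟨i, hi, rfl⟩ := Finset.mem_image.1 hx
          exact Finset.mem_range.2 (hg i (Finset.mem_range.1 hi))
        have hcard : ((Finset.range I.k).image g).card = I.k := by
          rw [Finset.card_image_of_injOn, Finset.card_range]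
          intro i hi j hj e
          exact hinj i (by simpa using hi) j (by simpa using hj) e
        have heq := Finset.eq_of_subset_of_card_le himg (by simpa [hcard] using hB.le)
        refine ⟨by simpa [hcard] using (congrArg Finset.card heq).symm, fun j hj => ?_⟩
        obtain ⟨i, hi, rfl⟩ := Finset.mem_image.1 (heq ▸ Finset.mem_range.2 hj)
        have hi := Finset.mem_range.1 hi
        exact (hlt (Q i) (g i) hj (hBg i hi).le).trans (hQw i hi)
      · push Not at hall
        obtain ⟨i, hi, hne⟩ := hall
        rcases hB.cover _ (hmem (Q i) ⟨i, hi, hQA i hi⟩) with ⟨j, hj, e⟩ | ⟨e, h''⟩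
        · exact absurd e (hne j hj)
        · exact ⟨e, fun j hj => (hlt (Q i) j hj (h'' j hj).le).trans (hQw i hi)⟩

/-- The beam of the last level is a solution. -/
theorem exists_isSolution (h : I.IsBeam I.n A r) :
    ∃ P : Fin r → I.G.Path I.s I.t, (∀ i : Fin r, A i = code (P i).1.getVert I.n) ∧
      I.IsSolution (List.ofFn P) := by
  have hP : ∀ i : Fin r, ∃ P : I.G.Path I.s I.t, A i = code P.1.getVert I.n ∧
      walkWeight P.1 = I.key (A i) I.n := by
    intro i
    obtain ⟨f, h0, hf, e⟩ := h.isPrefix i i.2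
    have hk := h.finite I.n_pos i i.2
    rw [e] at hk
    obtain ⟨P, hP, hw⟩ := I.exists_path_of_key_lt f I.n h0 (fun a b hab hb => hf a b hab hb.le) hk
    have e' := e.trans (code_congr fun j hj => (hP j hj).symm)
    -- `P` is no heavier than the key, and since it extends the prefix, the key is also a lower
    -- bound for its weight.
    refine ⟨P, e', le_antisymm (e ▸ hw) ?_⟩
    rw [e']
    exact I.key_le_walkWeight P _
  choose P hP hw using hP
  have hcov : ∀ Q, Q ∉ List.ofFn P → r = I.k ∧ ∀ i < r, I.key (A i) I.n ≤ walkWeight Q.1 := by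
    intro Q hQ
    rcases h.cover Q with ⟨i, hi, e⟩ | h'
    · refine absurd (List.mem_ofFn.2 ⟨⟨i, hi⟩, I.path_eq_of_code_eq ?_⟩) hQ
      rw [← hP, ← e]
    · exact h'
  refine ⟨P, hP, ?_, ?_, ?_, ?_, ?_⟩
  · refine List.nodup_ofFn.2 fun i j e => Fin.ext (h.injective i.2 j.2 ?_)
    rw [hP, hP, e]
  · simpa using h.le
  · intro hlt Q
    by_contra hQ
    have := (hcov Q hQ).1
    simp at hlt
    omega
  · refine List.pairwise_ofFn.2 fun i j hij => I.cost_le_of_walkWeight_le ?_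
    rw [hw, hw]
    refine key_le_key_of_rank_lt ?_ ?_ (h.sorted i j hij j.2) <;>
      exact hP _ ▸ code_lt_codeBound _ le_rfl
  · intro Q hQ Q' hQ'
    obtain ⟨i, rfl⟩ := List.mem_ofFn.1 hQ
    refine I.cost_le_of_walkWeight_le ?_
    rw [hw]
    exact (hcov Q' hQ').2 i i.2

end IsBeam

end KPathsInstance

/-! ## The program -/

namespace Ram

instance : Add Expr := ⟨.bin .add⟩
instance : Sub Expr := ⟨.bin .sub⟩
instance : Mul Expr := ⟨.bin .mul⟩
instance : Div Expr := ⟨.bin .div⟩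
instance (n : ℕ) : OfNat Expr n := ⟨.const n⟩

@[simp] theorem Expr.eval_add (m : State) (e f : Expr) : (e + f).eval m = e.eval m + f.eval m := rfl
@[simp] theorem Expr.eval_sub (m : State) (e f : Expr) : (e - f).eval m = e.eval m - f.eval m := rfl
@[simp] theorem Expr.eval_mul (m : State) (e f : Expr) : (e * f).eval m = e.eval m * f.eval m := rfl
@[simp] theorem Expr.eval_div (m : State) (e f : Expr) : (e / f).eval m = e.eval m / f.eval m := rfl
@[simp] theorem Expr.eval_ofNat (m : State) (n : ℕ) :
    (no_index (OfNat.ofNat n) : Expr).eval m = (OfNat.ofNat n : ℕ) := rfl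
@[simp] theorem Expr.eval_var (m : State) (x : ℕ) : (Expr.var x).eval m = m.var x := rfl
@[simp] theorem Expr.eval_cell (m : State) (a : ℕ) (i : Expr) :
    (Expr.cell a i).eval m = m.arr a (i.eval m) := rfl

/-- The execution of a list of programs in order. -/
def Cmd.block : List Cmd → Cmd
  | [] => .skip
  | [c] => c
  | c :: l => .seq c (block l)

notation "vLen" => 0
notation "vN" => 1
notation "vQ" => 2
notation "vS" => 3
notation "vT" => 4
notation "vK" => 5
notation "vBlock" => 6
notation "vBase" => 7
notation "vInf" => 8
notation "vBound" => 9
notation "vCode" => 10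
notation "vLast" => 11
notation "vKey" => 12
notation "vI" => 13
notation "vJ" => 14
notation "vV" => 15
notation "vX" => 16
notation "vAcc" => 17
notation "vSel" => 18
notation "vCarry" => 19
notation "vTmp" => 20
notation "vPlace" => 21
notation "vLevel" => 22
notation "vElem" => 23
notation "vBeam" => 24
notation "vPrefix" => 25
notation "vNext" => 26
notation "vPos" => 27
notation "vCount" => 28
notation "aIn" => 0
notation "aOut" => 1
notation "aPow" => 2
notation "aArc" => 3
notation "aBeam" => 4
notation "aSel" => 5
notation "aVis" => 6
notation "aDist" => 7

open Ram.Cmd Ram.Expr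

/-- Reading the header of the input. -/
def readHeader : Cmd := block [
  assign vN (cell aIn 0), assign vQ (cell aIn 1), assign vS (cell aIn 2), assign vT (cell aIn 3),
  assign vK (cell aIn 4), assign vBlock (var vQ + 1)]

/-- The base of the scalar weights and the powers of the number of vertices. -/
def computeBase : Cmd := block [
  assign vBase 1,
  loop vI vLen (assign vBase (var vBase + cell aIn (var vI))),
  assign vBase (var vBase * var vN),
  store aPow 0 1,
  loop vI vN (store aPow (var vI + 1) (cell aPow (var vI) * var vN)),
  assign vBound (cell aPow (var vN) * var vN),
  -- Extracting the digit with index `n` requires the powers with exponents `n` and `n + 1`.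
  store aPow (var vN + 1) (var vBound)]

/-- The upper bound for the scalar weights of paths. -/
def computeInf : Cmd := block [
  assign vInf 1,
  -- The base comes from an earlier phase, so it is admissible as a right factor.
  loop vI vQ (assign vInf (var vInf * var vBase))]

/-- The scalar weight of the arc from `vI` to `vJ`. -/
def computeArc : Cmd := block [
  -- The header of the input has `5` entries, and every pair of vertices has a block of `q + 1`
  -- entries.
  assign vX ((var vI * var vN + var vJ) * var vBlock + 5),
  assign vAcc 0,
  loop vV vQ (assign vAcc (var vAcc * var vBase + cell aIn (var vX + 1 + var vV))),
  ite (cell aIn (var vX)) skip (assign vAcc (var vInf)),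
  -- The sum of the two truncated differences vanishes exactly if the vertices are equal.
  ite ((var vI - var vT) + (var vT - var vI)) skip
    (ite ((var vJ - var vT) + (var vT - var vJ)) (assign vAcc (var vInf)) (assign vAcc 0)),
  store aArc (var vI * var vN + var vJ) (var vAcc)]

/-- The scalar weights of the arcs. -/
def computeArcs : Cmd := loop vI vN (loop vJ vN computeArc)

/-- The expression for a digit of a code. -/
def digitExpr (c i : Expr) : Expr := c / cell aPow i - c / cell aPow (i + 1) * var vN

/-- Marking the visited vertices. -/
def computeVisited : Cmd := block [
  loop vV vN (store aVis (var vV) 0),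
  -- `vLast` is written in this phase and cannot bound a loop. The loop runs to `n` instead, and a
  -- test makes the surplus rounds idle; loops over the beam and the selection are treated alike.
  loop vI vN (ite (var vLast - var vI) (store aVis (digitExpr (var vCode) (var vI)) 1) skip),
  store aVis (var vT) 0]

/-- The distances from the vertex `vV` after one more arc. -/
def computeRow : Cmd := block [
  assign vAcc (var vInf),
  -- With truncated subtraction `a - (a - b)` is the minimum of `a` and `b`.
  ite (cell aVis (var vV)) skip (loop vX vN (assign vAcc (var vAcc -
    (var vAcc - (cell aArc (var vV * var vN + var vX) + cell aDist (var vJ * var vN + var vX)))))),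
  store aDist (var vJ * var vN + var vV + var vN) (var vAcc)]

/-- The distances to the destination. -/
def computeDist : Cmd := block [
  loop vV vN (store aDist (var vV) (var vInf)),
  store aDist (var vT) 0,
  loop vJ vN (loop vV vN computeRow)]

/-- The key of the code `vCode` with last index `vLast`. -/
def computeKey : Cmd := block [
  computeVisited,
  computeDist,
  assign vKey (cell aDist (var vN * var vN + digitExpr (var vCode) (var vLast))),
  loop vI vN (ite (var vLast - var vI) (assign vKey (var vKey +
    cell aArc (digitExpr (var vCode) (var vI) * var vN + digitExpr (var vCode) (var vI + 1)))) skip)]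

/-- The insertion of the number `vCarry` into the selection. -/
def insertCarry : Cmd := block [
  loop vPlace vK (ite (var vSel - var vPlace)
    (ite (cell aSel (var vPlace) - var vCarry)
      (block [assign vTmp (cell aSel (var vPlace)), store aSel (var vPlace) (var vCarry),
        assign vCarry (var vTmp)]) skip) skip),
  ite (var vK - var vSel)
    (block [store aSel (var vSel) (var vCarry), assign vSel (var vSel + 1)]) skip]

/-- The extension of the prefix `vPrefix` by the vertex `vNext`. -/
def tryExtension : Cmd := block [
  assign vCode (var vPrefix + var vNext * cell aPow (var vLevel + 1)),
  assign vLast (var vLevel + 1),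
  computeKey,
  ite (var vInf - var vKey)
    (block [assign vCarry (var vKey * var vBound + var vCode), insertCarry]) skip]

/-- One level of the beam search. -/
def nextLevel : Cmd := block [
  assign vSel 0,
  loop vElem vK (ite (var vBeam - var vElem)
    (block [assign vPrefix (cell aBeam (var vElem)), loop vNext vN tryExtension]) skip),
  loop vElem vK (store aBeam (var vElem)
    (cell aSel (var vElem) - cell aSel (var vElem) / var vBound * var vBound)),
  assign vBeam (var vSel)]

/-- The beam search. -/
def beamSearch : Cmd := block [
  -- This is the minimum of `1` and `k`.
  assign vBeam (1 - (1 - var vK)),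
  store aBeam 0 (var vS),
  loop vLevel vN nextLevel]

/-- Writing the path with code `vCode` to position `vPos`. -/
def writePath : Cmd := block [
  assign vCount 1,
  -- The padding is written as well, but it is not counted: the next path overwrites it, or it lies
  -- beyond the end of the output.
  loop vJ vN (block [
    assign vX (digitExpr (var vCode) (var vJ)),
    store aOut (var vPos + 1 + var vJ) (var vX),
    ite ((var vX - var vT) + (var vT - var vX)) (assign vCount (var vCount + 1)) skip]),
  store aOut (var vPos) (var vCount),
  assign vPos (var vPos + 1 + var vCount)]

/-- Writing the output. -/
def writeOutput : Cmd := block [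
  store aOut 0 (var vBeam),
  assign vPos 1,
  loop vI vK (ite (var vBeam - var vI)
    (block [assign vCode (cell aBeam (var vI)), writePath]) skip),
  assign vLen (var vPos)]

/-- No phase writes to its own loop bounds or right factors. This is the purpose of the division
into phases, and it is a decidable property of the text. -/
theorem readHeader_tame : readHeader.Tame readHeader.vars readHeader.arrs := by decide
theorem computeBase_tame : computeBase.Tame computeBase.vars computeBase.arrs := by decide
theorem computeInf_tame : computeInf.Tame computeInf.vars computeInf.arrs := by decide
theorem computeArcs_tame : computeArcs.Tame computeArcs.vars computeArcs.arrs := by decide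
theorem beamSearch_tame : beamSearch.Tame beamSearch.vars beamSearch.arrs := by decide
theorem writeOutput_tame : writeOutput.Tame writeOutput.vars writeOutput.arrs := by decide

end Ram

namespace Ram

open Ram.Cmd Ram.Expr

/-! ## Correctness of the program -/

theorem Frame.var' {X Y : List ℕ} {m m' : State} (h : Frame X Y m m') (x : ℕ)
    (hx : x ∉ X := by decide) : m'.var x = m.var x := h.var x hx

theorem Frame.arr' {X Y : List ℕ} {m m' : State} (h : Frame X Y m m') (a : ℕ)
    (ha : a ∉ Y := by decide) (i : ℕ) : m'.arr a i = m.arr a i := h.arr a ha i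

/-- The data of the instance that are needed for the beam search are in the memory. -/
structure Env (I : KPathsInstance) (m : State) : Prop where
  n : m.var vN = I.n
  s : m.var vS = I.s
  t : m.var vT = I.t
  k : m.var vK = I.k
  inf : m.var vInf = I.inf
  bound : m.var vBound = I.codeBound
  pow : ∀ i ≤ I.n + 1, m.arr aPow i = I.n ^ i
  arc : ∀ u < I.n, ∀ v < I.n, m.arr aArc (u * I.n + v) = I.arcN u v

variable {I : KPathsInstance} {m : State}

theorem Env.frame {X Y : List ℕ} {m' : State} (h : Env I m) (hF : Frame X Y m m')
    (hX : ∀ x ∈ [vN, vS, vT, vK, vInf, vBound], x ∉ X := by decide)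
    (hY : ∀ a ∈ [aPow, aArc], a ∉ Y := by decide) : Env I m' := by
  simp only [List.mem_cons, List.not_mem_nil, or_false, forall_eq_or_imp, forall_eq] at hX hY
  obtain ⟨h1, h2, h3, h4, h5, h6⟩ := hX
  obtain ⟨h7, h8⟩ := hY
  exact ⟨(hF.var _ h1).trans h.n, (hF.var _ h2).trans h.s, (hF.var _ h3).trans h.t,
    (hF.var _ h4).trans h.k, (hF.var _ h5).trans h.inf, (hF.var _ h6).trans h.bound,
    fun i hi => (hF.arr _ h7 i).trans (h.pow i hi),
    fun u hu v hv => (hF.arr _ h8 _).trans (h.arc u hu v hv)⟩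

theorem Env.run (h : Env I m) (c : Cmd)
    (hX : ∀ x ∈ [vN, vS, vT, vK, vInf, vBound], x ∉ c.vars := by decide)
    (hY : ∀ a ∈ [aPow, aArc], a ∉ c.arrs := by decide) : Env I (c.run m) :=
  h.frame (c.frame_run m) hX hY

/-- The quotient by `n ^ (i + 1)` is the quotient by `n ^ i` divided once more by `n`, so the
difference is a remainder modulo `n`. -/
theorem Env.eval_digitExpr (h : Env I m) (c i : Expr) (hi : i.eval m ≤ I.n) :
    (digitExpr c i).eval m = digit I.n (c.eval m) (i.eval m) := by
  simp only [digitExpr, eval_sub, eval_div, eval_mul, eval_cell, eval_add, eval_ofNat, eval_var, h.n,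
    h.pow _ (show i.eval m ≤ I.n + 1 by omega), h.pow _ (show i.eval m + 1 ≤ I.n + 1 by omega), digit]
  rw [pow_succ, ← Nat.div_div_eq_div_mul, mul_comm]
  exact (Nat.mod_eq_sub_mul_div).symm

theorem digit_lt (I : KPathsInstance) (c i : ℕ) : digit I.n c i < I.n := Nat.mod_lt _ I.n_pos

theorem row_injective {n u v x y : ℕ} (hv : v < n) (hy : y < n) (h : u * n + v = x * n + y) :
    u = x ∧ v = y := by
  have h1 := congrArg (· / n) h
  have h2 := congrArg (· % n) h
  simp only [Nat.mul_add_mod_self_right, Nat.mod_eq_of_lt hv, Nat.mod_eq_of_lt hy] at h2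
  subst h2
  exact ⟨Nat.eq_of_mul_eq_mul_right (by omega) (Nat.add_right_cancel h), rfl⟩

theorem computeVisited_spec (h : Env I m) (hl : m.var vLast ≤ I.n) :
    ∀ v < I.n, (computeVisited.run m).arr aVis v ≠ 0 ↔ I.Visited (m.var vCode) (m.var vLast) v := by
  set m₁ := (loop vV vN (store aVis (var vV) 0)).run m with hm₁
  have h1 : ∀ v < I.n, m₁.arr aVis v = 0 := by
    have := loop_induction (m := m) (x := vV) (y := vN) (c := store aVis (var vV) 0)
      (fun i m' => ∀ v < i, m'.arr aVis v = 0) (by simp) (by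
        intro i m' hi hx hF ih v hv
        by_cases hvi : v = i
        · simp [Cmd.run, hx, hvi]
        · simp [Cmd.run, hx, hvi, ih v (by omega)])
    rwa [h.n] at this
  have e₁ : Env I m₁ := h.run _
  have hc₁ : m₁.var vCode = m.var vCode := run_var (by decide) _
  have hl₁ : m₁.var vLast = m.var vLast := run_var (by decide) _
  set c₂ := loop vI vN (ite (var vLast - var vI)
    (store aVis (digitExpr (var vCode) (var vI)) 1) skip) with hc₂
  set m₂ := c₂.run m₁ with hm₂
  have h2 : ∀ v < I.n, m₂.arr aVis v ≠ 0 ↔ ∃ i < I.n, i < m.var vLast ∧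
      digit I.n (m.var vCode) i = v := by
    have := loop_induction (m := m₁) (x := vI) (y := vN) (c := ite (var vLast - var vI)
      (store aVis (digitExpr (var vCode) (var vI)) 1) skip)
      (fun i m' => ∀ v < I.n, m'.arr aVis v ≠ 0 ↔ ∃ j < i, j < m.var vLast ∧
        digit I.n (m.var vCode) j = v) (by simpa using h1) (by
        intro i m' hi hx hF ih v hv
        rw [e₁.n] at hi
        have e' := e₁.frame hF
        have hc' := (hF.var' vCode).trans hc₁
        have hl' := (hF.var' vLast).trans hl₁
        have hd := e'.eval_digitExpr (var vCode) (var vI) (by simp [hx]; omega)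
        simp only [eval_var, hc', hx] at hd
        simp only [Cmd.run, eval_sub, eval_var, hl', hx, hd, State.setVar_arr]
        split_ifs with hlt
        · simp only [State.setCell_arr, eval_ofNat, true_and]
          split_ifs with hv'
          · simp only [ne_eq, one_ne_zero, not_false_eq_true, true_iff]
            exact ⟨i, by omega, by omega, hv'.symm⟩
          · rw [ih v hv]
            constructor
            · rintro ⟨j, hj, h'⟩
              exact ⟨j, by omega, h'⟩
            · rintro ⟨j, hj, h', h''⟩
              refine ⟨j, ?_, h', h''⟩
              rcases Nat.lt_succ_iff_lt_or_eq.1 hj with hj | rfl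
              · exact hj
              · exact absurd h''.symm hv'
        · rw [ih v hv]
          constructor
          · rintro ⟨j, hj, h'⟩
            exact ⟨j, by omega, h'⟩
          · rintro ⟨j, hj, h', h''⟩
            exact ⟨j, by omega, h', h''⟩)
    rwa [e₁.n] at this
  have e₂ : Env I m₂ := e₁.run _
  intro v hv
  -- A padded prefix may have marked `t`; this mark is removed at the end.
  have : (computeVisited.run m).arr aVis v = if v = I.t then 0 else m₂.arr aVis v := by
    change (m₂.setCell aVis (m₂.var vT) 0).arr aVis v = _
    simp [e₂.t]
  rw [this, KPathsInstance.Visited]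
  split_ifs with hvt
  · simp [hvt]
  · rw [h2 v hv]
    simp only [hvt, ne_eq, not_false_eq_true, true_and]
    constructor
    · rintro ⟨i, -, h'⟩
      exact ⟨i, h'⟩
    · rintro ⟨i, hi, h'⟩
      exact ⟨i, by omega, hi, h'⟩

theorem computeRow_spec (h : Env I m) {V : ℕ → Prop} {v j : ℕ} (hv : v < I.n)
    (hV : m.arr aVis v ≠ 0 ↔ V v) (hvv : m.var vV = v) (hj : m.var vJ = j)
    (hD : ∀ x < I.n, m.arr aDist (j * I.n + x) = I.dist V j x) (i : ℕ) :
    (computeRow.run m).arr aDist i =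
      if i = j * I.n + v + I.n then I.dist V (j + 1) v else m.arr aDist i := by
  set m₁ := m.setVar vAcc I.inf with hm₁
  set c := assign vAcc (var vAcc - (var vAcc - (cell aArc (var vV * var vN + var vX) +
    cell aDist (var vJ * var vN + var vX)))) with hc
  have e₁ : Env I m₁ := by
    have := h.run (assign vAcc (var vInf))
    simpa [Cmd.run, h.inf] using this
  have h1 : ((loop vX vN c).run m₁).var vAcc =
      minUpTo I.inf (fun x => I.arcN v x + I.dist V j x) I.n := by
    have := loop_induction (m := m₁) (x := vX) (y := vN) (c := c)
      (fun i m' => m'.var vAcc = minUpTo I.inf (fun x => I.arcN v x + I.dist V j x) i)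
      (by simp [hm₁, minUpTo]) (by
        intro i m' hi hx hF ih
        rw [e₁.n] at hi
        have e' := e₁.frame hF
        have hv' : m'.var vV = v := (hF.var' vV).trans (by simpa [hm₁] using hvv)
        have hj' : m'.var vJ = j := (hF.var' vJ).trans (by simpa [hm₁] using hj)
        have hd' : m'.arr aDist (j * I.n + i) = I.dist V j i :=
          (hF.arr' aDist (by decide) _).trans (by simpa [hm₁] using hD i hi)
        simp [Cmd.run, hc, hx, hv', hj', ih, e'.n, hd', e'.arc v hv i hi, minUpTo]
        omega)
    rwa [e₁.n] at this
  have hrun : computeRow.run m = (store aDist (var vJ * var vN + var vV + var vN) (var vAcc)).run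
      ((ite (cell aVis (var vV)) skip (loop vX vN c)).run m₁) := by
    simp only [computeRow, block, Cmd.run, eval_var, h.inf]
    rfl
  set c' := ite (cell aVis (var vV)) skip (loop vX vN c) with hc'
  have hacc : (c'.run m₁).var vAcc = I.dist V (j + 1) v := by
    rw [hc', Cmd.run, KPathsInstance.dist]
    have : (cell aVis (var vV)).eval m₁ = m.arr aVis v := by simp [hm₁, hvv]
    rw [this]
    by_cases hVv : V v
    · rw [if_pos (hV.2 hVv), if_pos hVv]
      simp [Cmd.run, hm₁]
    · rw [if_neg (fun h' => hVv (hV.1 h')), if_neg hVv]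
      exact h1
  have e₂ : Env I (c'.run m₁) := e₁.run c'
  have hv₂ : (c'.run m₁).var vV = v := (run_var (by decide) _).trans (by simpa [hm₁] using hvv)
  have hj₂ : (c'.run m₁).var vJ = j := (run_var (by decide) _).trans (by simpa [hm₁] using hj)
  have hD₂ : ∀ i, (c'.run m₁).arr aDist i = m.arr aDist i := fun i =>
    (run_arr (by decide) _ _).trans (by simp [hm₁])
  rw [hrun]
  simp [Cmd.run, hacc, hv₂, hj₂, hD₂, e₂.n]

theorem computeDist_spec (h : Env I m) {V : ℕ → Prop}
    (hV : ∀ v < I.n, m.arr aVis v ≠ 0 ↔ V v) :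
    ∀ v < I.n, (computeDist.run m).arr aDist (I.n * I.n + v) = I.dist V I.n v := by
  set m₁ := (loop vV vN (store aDist (var vV) (var vInf))).run m with hm₁
  have h1 : ∀ v < I.n, m₁.arr aDist v = I.inf := by
    have := loop_induction (m := m) (x := vV) (y := vN) (c := store aDist (var vV) (var vInf))
      (fun i m' => ∀ v < i, m'.arr aDist v = I.inf) (by simp) (by
        intro i m' hi hx hF ih v hv
        by_cases hvi : v = i
        · simp [Cmd.run, hx, hvi, (h.frame hF).inf]
        · simp [Cmd.run, hx, hvi, ih v (by omega)])
    rwa [h.n] at this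
  have e₁ : Env I m₁ := h.run _
  set m₂ := (store aDist (var vT) 0).run m₁ with hm₂
  have e₂ : Env I m₂ := e₁.run _
  have hV₂ : ∀ v < I.n, m₂.arr aVis v ≠ 0 ↔ V v := by
    intro v hv
    rw [← hV v hv, hm₂, run_arr (by decide), hm₁, run_arr (by decide)]
  have h2 : ∀ v < I.n, m₂.arr aDist (0 * I.n + v) = I.dist V 0 v := by
    intro v hv
    simp [hm₂, Cmd.run, e₁.t, h1 v hv, KPathsInstance.dist]
  have := loop_induction (m := m₂) (x := vJ) (y := vN) (c := loop vV vN computeRow)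
    (fun j m' => ∀ v < I.n, m'.arr aDist (j * I.n + v) = I.dist V j v) (by simpa using h2) (by
      intro j m' hj hx hF ih v hv
      have e' := e₂.frame hF
      have hV' : ∀ v < I.n, m'.arr aVis v ≠ 0 ↔ V v := fun v hv => by
        rw [hF.arr' aVis]; exact hV₂ v hv
      -- Row `j + 1` is filled from row `j` in the same array, so the invariant records that row `j`
      -- stays intact.
      have := loop_induction (m := m') (x := vV) (y := vN) (c := computeRow)
        (fun i m'' => (∀ x < I.n, m''.arr aDist (j * I.n + x) = I.dist V j x) ∧
          ∀ x < i, m''.arr aDist (j * I.n + x + I.n) = I.dist V (j + 1) x)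
        (by simpa using ih) (by
          intro i m'' hi hx' hF' ⟨ih1, ih2⟩
          rw [e'.n] at hi
          have e'' := e'.frame hF'
          have hj'' : m''.var vJ = j := (hF'.var' vJ).trans hx
          have spec := computeRow_spec e'' (V := V) hi
            (by rw [hF'.arr' aVis]; exact hV' i hi) hx' hj'' ih1
          refine ⟨fun x hx => ?_, fun x hx => ?_⟩
          · rw [State.setVar_arr, spec, if_neg (by omega)]
            exact ih1 x hx
          · rw [State.setVar_arr, spec]
            by_cases hxi : x = i
            · rw [if_pos (by rw [hxi]), hxi]
            · rw [if_neg (by omega)]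
              exact ih2 x (by omega))
      rw [e'.n] at this
      rw [State.setVar_arr, show (j + 1) * I.n + v = j * I.n + v + I.n by ring]
      exact this.2 v hv)
  rw [e₂.n] at this
  exact this

theorem computeKey_spec (h : Env I m) (hl : m.var vLast ≤ I.n) :
    (computeKey.run m).var vKey = I.key (m.var vCode) (m.var vLast) := by
  set C := m.var vCode with hC
  set l := m.var vLast with hL
  set m₁ := computeVisited.run m with hm₁
  have e₁ : Env I m₁ := h.run _
  set m₂ := computeDist.run m₁ with hm₂
  have e₂ : Env I m₂ := e₁.run _
  have hD := computeDist_spec e₁ (computeVisited_spec h hl)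
  rw [← hm₂] at hD
  have hC₂ : m₂.var vCode = C := (run_var (by decide) _).trans (run_var (by decide) _)
  have hl₂ : m₂.var vLast = l := (run_var (by decide) _).trans (run_var (by decide) _)
  set c₃ := assign vKey (cell aDist (var vN * var vN + digitExpr (var vCode) (var vLast)))
  set m₃ := c₃.run m₂ with hm₃
  have e₃ : Env I m₃ := e₂.run _
  have hC₃ : m₃.var vCode = C := (run_var (by decide) _).trans hC₂
  have hl₃ : m₃.var vLast = l := (run_var (by decide) _).trans hl₂
  have h3 : m₃.var vKey = I.dist (I.Visited C l) I.n (digit I.n C l) := by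
    have hd := e₂.eval_digitExpr (var vCode) (var vLast) (by simpa [hl₂] using hl)
    simp only [eval_var, hC₂, hl₂] at hd
    rw [← hD _ (digit_lt I C l)]
    simp [hm₃, c₃, Cmd.run, hd, e₂.n]
  -- Only the first `l` of the `n` rounds contribute, hence the range `min i l`.
  have := loop_induction (m := m₃) (x := vI) (y := vN) (c := ite (var vLast - var vI)
    (assign vKey (var vKey + cell aArc (digitExpr (var vCode) (var vI) * var vN +
      digitExpr (var vCode) (var vI + 1)))) skip)
    (fun i m' => m'.var vKey = ∑ j ∈ Finset.range (min i l),
      I.arcN (digit I.n C j) (digit I.n C (j + 1)) + I.dist (I.Visited C l) I.n (digit I.n C l))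
    (by simpa using h3) (by
      intro i m' hi hx hF ih
      rw [e₃.n] at hi
      have e' := e₃.frame hF
      have hC' := (hF.var' vCode).trans hC₃
      have hl' := (hF.var' vLast).trans hl₃
      have hd := e'.eval_digitExpr (var vCode) (var vI) (by simp [hx]; omega)
      have hd' := e'.eval_digitExpr (var vCode) (var vI + 1) (by simp [hx]; omega)
      simp only [eval_var, eval_add, eval_ofNat, hC', hx] at hd hd'
      simp only [Cmd.run, eval_sub, eval_var, hl', hx]
      split_ifs with hlt
      · rw [show min (i + 1) l = min i l + 1 by omega, Finset.sum_range_succ,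
          show min i l = i by omega]
        rw [show min i l = i by omega] at ih
        simp only [State.setVar_var, eval_add, eval_var, eval_cell, eval_mul, hd, hd', e'.n, ih,
          e'.arc _ (digit_lt I C i) _ (digit_lt I C (i + 1))]
        simp
        ring
      · rw [show min (i + 1) l = min i l by omega]
        simpa using ih)
  rw [e₃.n, show min I.n l = l by omega] at this
  exact this

end Ram

/-! ### Correctness of the levels of the beam search. -/

namespace KPathsInstance

variable {I : KPathsInstance}

theorem IsBeam.congr {l r : ℕ} {A A' : ℕ → ℕ} (h : I.IsBeam l A r) (hA : ∀ i < r, A' i = A i) :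
    I.IsBeam l A' r where
  le := h.le
  sorted i j hij hj := by rw [hA i (by omega), hA j hj]; exact h.sorted i j hij hj
  isPrefix i hi := by rw [hA i hi]; exact h.isPrefix i hi
  finite hl i hi := by rw [hA i hi]; exact h.finite hl i hi
  cover P := by
    rcases h.cover P with ⟨i, hi, e⟩ | ⟨e, h'⟩
    · exact .inl ⟨i, hi, (hA i hi).trans e⟩
    · exact .inr ⟨e, fun i hi => by rw [hA i hi]; exact h' i hi⟩

/-- Extensions are tried in the lexicographic order of `(i, v)`. This lemma is one step of it; the
next two are the passage to a new row and an idle row beyond the beam. -/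
theorem isCandidate_succ {l r i v : ℕ} {A : ℕ → ℕ} (hi : i < r) (hv : v < I.n) (y : ℕ) :
    I.IsCandidate l A r i (v + 1) y ↔ I.IsCandidate l A r i v y ∨
      (I.key (A i + v * I.n ^ (l + 1)) (l + 1) < I.inf ∧
        y = I.rank (l + 1) (A i + v * I.n ^ (l + 1))) := by
  constructor
  · rintro ⟨i', v', h, h'⟩
    by_cases e : i' = i ∧ v' = v
    · obtain ⟨rfl, rfl⟩ := e
      exact .inr h'.2.2
    · exact .inl ⟨i', v', by omega, h'⟩
  · rintro (⟨i', v', h, h'⟩ | h)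
    · exact ⟨i', v', by omega, h'⟩
    · exact ⟨i, v, by omega, hi, hv, h⟩

theorem isCandidate_row {l r i : ℕ} {A : ℕ → ℕ} (y : ℕ) :
    I.IsCandidate l A r i I.n y ↔ I.IsCandidate l A r (i + 1) 0 y := by
  constructor
  · rintro ⟨i', v', h, h'⟩
    exact ⟨i', v', by omega, h'⟩
  · rintro ⟨i', v', h, h'⟩
    have := h'.2.1
    exact ⟨i', v', by omega, h'⟩

theorem isCandidate_of_le {l r i : ℕ} {A : ℕ → ℕ} (hi : r ≤ i) (y : ℕ) :
    I.IsCandidate l A r i 0 y ↔ I.IsCandidate l A r (i + 1) 0 y := by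
  constructor
  · rintro ⟨i', v', h, h'⟩
    exact ⟨i', v', by omega, h'⟩
  · rintro ⟨i', v', h, h'⟩
    have := h'.1
    exact ⟨i', v', by omega, h'⟩

end KPathsInstance

namespace Ram

open Ram.Cmd Ram.Expr

variable {I : KPathsInstance} {m : State}

theorem insertCarry_spec {k x : ℕ} {S : ℕ → Prop} (hk : m.var vK = k)
    (hS : IsSelection k S (m.arr aSel) (m.var vSel)) (hx : ¬ S x) (hc : m.var vCarry = x) :
    IsSelection k (fun y => S y ∨ y = x) ((insertCarry.run m).arr aSel)
      ((insertCarry.run m).var vSel) := by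
  set A := m.arr aSel with hA
  set r := m.var vSel with hr
  set c := ite (var vSel - var vPlace)
    (ite (cell aSel (var vPlace) - var vCarry)
      (block [assign vTmp (cell aSel (var vPlace)), store aSel (var vPlace) (var vCarry),
        assign vCarry (var vTmp)]) skip) skip with hcdef
  set m₁ := (loop vPlace vK c).run m with hm₁
  have hr₁ : m₁.var vSel = r := run_var (by decide) _
  have hk₁ : m₁.var vK = k := (run_var (by decide) _).trans hk
  -- Rounds from `r` on change nothing, so running to `k` instead of `r` is harmless.
  have h1 : IsInsertion A r x k (m₁.arr aSel) (m₁.var vCarry) := by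
    have := loop_induction (m := m) (x := vPlace) (y := vK) (c := c)
      (fun i m' => IsInsertion A r x i (m'.arr aSel) (m'.var vCarry))
      (by simpa [hc] using hS.isInsertion hx) (by
        intro i m' hi hx' hF ih
        have hr' : m'.var vSel = r := hF.var' vSel
        simp only [hcdef, Cmd.run, eval_sub, eval_var, eval_cell, hr', hx', State.setVar_arr]
        split_ifs with h₁ h₂
        · have := ih.swap (B' := fun j => if j = i then m'.var vCarry else m'.arr aSel j)
            (by omega) (by omega) (by simp) (fun j _ hj => by simp [hj])
          convert this using 1
          · ext j
            simp [block, Cmd.run, hx']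
          · simp [block, Cmd.run, hx']
        · simpa using ih.skip fun _ => by omega
        · simpa using ih.skip fun h => by omega)
    rwa [hk] at this
  have hrun : insertCarry.run m = (ite (var vK - var vSel)
    (block [store aSel (var vSel) (var vCarry), assign vSel (var vSel + 1)]) skip).run m₁ := rfl
  rw [hrun]
  simp only [Cmd.run, eval_sub, eval_var, hr₁, hk₁]
  have hle := hS.le
  split_ifs with h
  · have e : ((block [store aSel (var vSel) (var vCarry), assign vSel (var vSel + 1)]).run m₁).var
        vSel = r + 1 := by simp [block, Cmd.run, hr₁]
    rw [e]
    refine hS.insert_of_lt h1 (by omega) (by omega) (fun j hj => ?_) ?_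
    · simp [block, Cmd.run, hr₁, hj.ne]
    · simp [block, Cmd.run, hr₁]
  · obtain rfl : r = k := by omega
    rw [hr₁]
    exact hS.insert_of_eq h1 le_rfl

theorem tryExtension_spec {l r i v : ℕ} {A : ℕ → ℕ} (h : Env I m) (hA : I.IsBeam l A r)
    (hl : l < I.n) (hi : i < r) (hv : v < I.n) (hlev : m.var vLevel = l) (hpre : m.var vPrefix = A i)
    (hnext : m.var vNext = v)
    (hS : IsSelection I.k (I.IsCandidate l A r i v) (m.arr aSel) (m.var vSel)) :
    IsSelection I.k (I.IsCandidate l A r i (v + 1)) ((tryExtension.run m).arr aSel)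
      ((tryExtension.run m).var vSel) := by
  set m₁ := (block [assign vCode (var vPrefix + var vNext * cell aPow (var vLevel + 1)),
    assign vLast (var vLevel + 1)]).run m with hm₁
  have e₁ : Env I m₁ := h.run _
  have hcode₁ : m₁.var vCode = A i + v * I.n ^ (l + 1) := by
    simp [hm₁, block, Cmd.run, hpre, hnext, hlev, h.pow (l + 1) (by omega)]
  have hlast₁ : m₁.var vLast = l + 1 := by simp [hm₁, block, Cmd.run, hlev]
  set m₂ := computeKey.run m₁ with hm₂
  have e₂ : Env I m₂ := e₁.run _
  have hkey : m₂.var vKey = I.key (A i + v * I.n ^ (l + 1)) (l + 1) := by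
    rw [hm₂, computeKey_spec e₁ (by omega), hcode₁, hlast₁]
  have hcode₂ : m₂.var vCode = A i + v * I.n ^ (l + 1) := (run_var (by decide) _).trans hcode₁
  have hS₂ : IsSelection I.k (I.IsCandidate l A r i v) (m₂.arr aSel) (m₂.var vSel) := by
    have ha : m₂.arr aSel = m.arr aSel := funext fun j =>
      (run_arr (by decide) _ _).trans (run_arr (by decide) _ _)
    have hb : m₂.var vSel = m.var vSel := (run_var (by decide) _).trans (run_var (by decide) _)
    rw [ha, hb]
    exact hS
  have hrun : tryExtension.run m = (ite (var vInf - var vKey)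
    (block [assign vCarry (var vKey * var vBound + var vCode), insertCarry]) skip).run m₂ := rfl
  rw [hrun]
  simp only [Cmd.run, eval_sub, eval_var, e₂.inf, hkey]
  split_ifs with hlt
  · set m₃ := (assign vCarry (var vKey * var vBound + var vCode)).run m₂ with hm₃
    have hcarry : m₃.var vCarry = I.rank (l + 1) (A i + v * I.n ^ (l + 1)) := by
      simp [hm₃, Cmd.run, hkey, e₂.bound, hcode₂, KPathsInstance.rank]
    have hsel : m₃.var vSel = m₂.var vSel := run_var (by decide) _
    have := insertCarry_spec (m := m₃) (e₂.run _).k (by rw [hsel]; exact hS₂)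
      (hA.not_isCandidate_self hl hi hv) hcarry
    refine this.congr (fun y => ?_) (fun _ _ => rfl)
    rw [KPathsInstance.isCandidate_succ hi hv]
    simp [show I.key (A i + v * I.n ^ (l + 1)) (l + 1) < I.inf by omega]
  · refine hS₂.congr (fun y => ?_) (fun _ _ => rfl)
    rw [KPathsInstance.isCandidate_succ hi hv]
    simp [show ¬ I.key (A i + v * I.n ^ (l + 1)) (l + 1) < I.inf by omega]

theorem nextLevel_spec {l : ℕ} (h : Env I m) (hl : l < I.n) (hlev : m.var vLevel = l)
    (hA : I.IsBeam l (m.arr aBeam) (m.var vBeam)) :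
    I.IsBeam (l + 1) ((nextLevel.run m).arr aBeam) ((nextLevel.run m).var vBeam) := by
  set A := m.arr aBeam with hAdef
  set r := m.var vBeam with hr
  set m₁ := (assign vSel 0).run m with hm₁
  have e₁ : Env I m₁ := h.run _
  set c := ite (var vBeam - var vElem)
    (block [assign vPrefix (cell aBeam (var vElem)), loop vNext vN tryExtension]) skip with hc
  set m₂ := (loop vElem vK c).run m₁ with hm₂
  have e₂ : Env I m₂ := e₁.run _
  have hsel : IsSelection I.k (I.IsCandidate l A r I.k 0) (m₂.arr aSel) (m₂.var vSel) := by
    have := loop_induction (m := m₁) (x := vElem) (y := vK) (c := c)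
      (fun i m' => IsSelection I.k (I.IsCandidate l A r i 0) (m'.arr aSel) (m'.var vSel))
      (by
        have : (m₁.setVar vElem 0).var vSel = 0 := by simp [hm₁, Cmd.run]
        rw [this]
        refine isSelection_empty _ ?_ _
        rintro y ⟨i, v, h, -⟩
        omega) (by
        intro i m' hi hx hF ih
        have e' := e₁.frame hF
        have hr' : m'.var vBeam = r := hF.var' vBeam
        have hA' : ∀ j, m'.arr aBeam j = A j := hF.arr' aBeam
        have hlev' : m'.var vLevel = l := (hF.var' vLevel).trans hlev
        simp only [hc, Cmd.run, eval_sub, eval_var, hr', hx, State.setVar_arr]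
        split_ifs with hlt
        · set m₃ := (assign vPrefix (cell aBeam (var vElem))).run m' with hm₃
          have e₃ : Env I m₃ := e'.run _
          have hpre : m₃.var vPrefix = A i := by simp [hm₃, Cmd.run, hx, hA']
          have := loop_induction (m := m₃) (x := vNext) (y := vN) (c := tryExtension)
            (fun v m'' => IsSelection I.k (I.IsCandidate l A r i v) (m''.arr aSel) (m''.var vSel))
            (by simpa [hm₃, Cmd.run] using ih) (by
              intro v m'' hv hx'' hF'' ih''
              rw [e₃.n] at hv
              have := tryExtension_spec (e₃.frame hF'') hA hl (by omega) hv
                ((hF''.var' vLevel).trans ((run_var (by decide) _).trans hlev'))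
                ((hF''.var' vPrefix).trans hpre) hx'' ih''
              simpa using this)
          rw [e₃.n] at this
          have := this.congr (fun y => KPathsInstance.isCandidate_row y) fun _ _ => rfl
          rw [State.setVar_var, if_neg (by decide)]
          exact this
        · have := ih.congr (fun y => KPathsInstance.isCandidate_of_le (by omega) y) fun _ _ => rfl
          simpa using this)
    rwa [e₁.k] at this
  have hnext := hA.succ hl hsel
  set m₃ := (loop vElem vK (store aBeam (var vElem)
    (cell aSel (var vElem) - cell aSel (var vElem) / var vBound * var vBound))).run m₂ with hm₃
  -- The remainder of a rank is the code of the prefix. Cells past the selection receive meaningless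
  -- values, which the beam does not refer to.
  have h3 : ∀ i < I.k, m₃.arr aBeam i = m₂.arr aSel i % I.codeBound := by
    have := loop_induction (m := m₂) (x := vElem) (y := vK) (c := store aBeam (var vElem)
      (cell aSel (var vElem) - cell aSel (var vElem) / var vBound * var vBound))
      (fun i m' => ∀ j < i, m'.arr aBeam j = m₂.arr aSel j % I.codeBound) (by simp) (by
        intro i m' hi hx hF ih j hj
        have e' := e₂.frame hF
        have hs := hF.arr' aSel (by decide) i
        by_cases hji : j = i
        · simp only [Cmd.run, State.setVar_arr, State.setCell_arr, eval_var, hx, hji, and_self,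
            if_true, eval_sub, eval_cell, eval_mul, eval_div, e'.bound, hs]
          rw [mul_comm]
          exact Nat.mod_eq_sub_mul_div.symm
        · simp [Cmd.run, hx, hji, ih j (by omega)])
    rwa [e₂.k] at this
  have hsel₃ : m₃.var vSel = m₂.var vSel := run_var (by decide) _
  have hrun : nextLevel.run m = (assign vBeam (var vSel)).run m₃ := rfl
  rw [hrun]
  have hb : ((assign vBeam (var vSel)).run m₃).var vBeam = m₂.var vSel := by
    simp [Cmd.run, hsel₃]
  rw [hb]
  refine hnext.congr fun i hi => ?_
  rw [run_arr (by decide)]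
  exact h3 i (hi.trans_le hsel.le)

theorem beamSearch_spec (h : Env I m) :
    I.IsBeam I.n ((beamSearch.run m).arr aBeam) ((beamSearch.run m).var vBeam) := by
  set m₁ := (block [assign vBeam (1 - (1 - var vK)), store aBeam 0 (var vS)]).run m with hm₁
  have e₁ : Env I m₁ := h.run _
  have h1 : I.IsBeam 0 (m₁.arr aBeam) (m₁.var vBeam) := by
    refine KPathsInstance.isBeam_zero ?_ ?_
    · simp [hm₁, block, Cmd.run, h.k]
      omega
    · simp [hm₁, block, Cmd.run, h.s]
  have := loop_induction (m := m₁) (x := vLevel) (y := vN) (c := nextLevel)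
    (fun l m' => I.IsBeam l (m'.arr aBeam) (m'.var vBeam)) (by simpa using h1) (by
      intro l m' hl hx hF ih
      rw [e₁.n] at hl
      simpa using nextLevel_spec (e₁.frame hF) hl hx ih)
  rw [e₁.n] at this
  exact this

end Ram

/-! ### Layout of the input and the output. -/

/-- The list `l` is an initial segment of the sequence `f`. -/
def ListPrefix (l : List ℕ) (f : ℕ → ℕ) : Prop := ∀ (i : ℕ) (h : i < l.length), f i = l[i]

theorem ListPrefix.append {l l' : List ℕ} {f g : ℕ → ℕ} (h : ListPrefix l f)
    (hg : ∀ i < l.length, g i = f i)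
    (h' : ∀ (j : ℕ) (hj : j < l'.length), g (l.length + j) = l'[j]) : ListPrefix (l ++ l') g := by
  intro i hi
  rcases Nat.lt_or_ge i l.length with hl | hl
  · rw [List.getElem_append_left hl, hg i hl, h i hl]
  · rw [List.getElem_append_right hl, ← h']
    congr 1
    omega

theorem List.getD_flatMap_of_length_eq {α β : Type*} {f : α → List β} {b : ℕ} (d : β) (l : List α)
    (hf : ∀ a ∈ l, (f a).length = b) {i j : ℕ} (hi : i < l.length) (hj : j < b) :
    (l.flatMap f).getD (i * b + j) d = (f l[i]).getD j d := by
  induction l generalizing i with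
  | nil => simp at hi
  | cons a l ih =>
    have ha : (f a).length = b := hf a (by simp)
    rw [List.flatMap_cons]
    cases i with
    | zero => rw [zero_mul, zero_add, List.getD_append _ _ _ _ (by omega)]; rfl
    | succ i =>
      have hlen : (i + 1) * b + j = b + (i * b + j) := by ring
      rw [hlen, List.getD_append_right _ _ _ _ (by omega), ha, Nat.add_sub_cancel_left,
        ih (fun a ha => hf a (by simp [ha])) (by simpa using hi)]
      rfl

namespace KPathsInstance

variable (I : KPathsInstance)

open Classical in
/-- The block of the encoding that belongs to a pair of vertices. -/
noncomputable def pairBlock (u v : Fin I.n) : List ℕ :=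
  if I.G.Adj u v then 1 :: (List.finRange I.q).map fun i => I.w s(u, v) i
  else 0 :: (List.finRange I.q).map fun _ => 0

theorem length_pairBlock (u v : Fin I.n) : (I.pairBlock u v).length = I.q + 1 := by
  unfold pairBlock
  split_ifs <;> simp

theorem encode_eq : I.encode = [I.n, I.q, I.s.val, I.t.val, I.k] ++
    (List.finRange I.n).flatMap fun u => (List.finRange I.n).flatMap (I.pairBlock u) := rfl

theorem length_row (u : Fin I.n) :
    ((List.finRange I.n).flatMap (I.pairBlock u)).length = I.n * (I.q + 1) := by
  simp [List.length_flatMap, length_pairBlock]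

theorem length_encode : I.encode.length = 5 + I.n * (I.n * (I.q + 1)) := by
  rw [encode_eq]
  simp only [List.length_append, List.length_flatMap, length_pairBlock]
  simp

theorem encode_getD (u v : Fin I.n) {j : ℕ} (hj : j < I.q + 1) :
    I.encode.getD ((u * I.n + v) * (I.q + 1) + 5 + j) 0 = (I.pairBlock u v).getD j 0 := by
  have h1 : (v : ℕ) * (I.q + 1) + j < I.n * (I.q + 1) := by
    have := v.2
    calc (v : ℕ) * (I.q + 1) + j < (v + 1) * (I.q + 1) := by nlinarith
      _ ≤ _ := Nat.mul_le_mul_right _ this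
  rw [encode_eq, List.getD_append_right _ _ _ _ (by simp; omega)]
  have : (u * I.n + v) * (I.q + 1) + 5 + j - [I.n, I.q, I.s.val, I.t.val, I.k].length =
      u * (I.n * (I.q + 1)) + (v * (I.q + 1) + j) := by
    have e : ((u : ℕ) * I.n + v) * (I.q + 1) + 5 + j =
      u * (I.n * (I.q + 1)) + (v * (I.q + 1) + j) + 5 := by ring
    rw [e]
    rfl
  rw [this, List.getD_flatMap_of_length_eq 0 _ (fun u _ => I.length_row u) (by simp) h1,
    List.getD_flatMap_of_length_eq 0 _ (fun v _ => I.length_pairBlock _ v) (by simp) hj]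
  simp

theorem encode_adj (u v : Fin I.n) :
    I.encode.getD ((u * I.n + v) * (I.q + 1) + 5) 0 ≠ 0 ↔ I.G.Adj u v := by
  have := I.encode_getD u v (j := 0) (by omega)
  rw [add_zero] at this
  rw [this, pairBlock]
  split_ifs with h <;> simp [h]

theorem encode_weight {u v : Fin I.n} (h : I.G.Adj u v) {i : ℕ} (hi : i < I.q) :
    I.encode.getD ((u * I.n + v) * (I.q + 1) + 5 + 1 + i) 0 = I.crit s(u, v) i := by
  have := I.encode_getD u v (j := i + 1) (by omega)
  rw [show (u * I.n + v) * (I.q + 1) + 5 + 1 + i = (u * I.n + v) * (I.q + 1) + 5 + (i + 1) by ring,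
    this, pairBlock, if_pos h]
  simp [crit, hi]

end KPathsInstance

/-! ### Correctness of the phases for input and output. -/

namespace Ram

open Ram.Cmd Ram.Expr

variable {I : KPathsInstance} {m : State}

/-- The input and its header are in the memory. -/
structure Header (I : KPathsInstance) (m : State) : Prop where
  input : ∀ i, m.arr aIn i = I.encode.getD i 0
  len : m.var vLen = I.encode.length
  n : m.var vN = I.n
  q : m.var vQ = I.q
  s : m.var vS = I.s
  t : m.var vT = I.t
  k : m.var vK = I.k
  block : m.var vBlock = I.q + 1

theorem Header.frame {X Y : List ℕ} {m' : State} (h : Header I m) (hF : Frame X Y m m')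
    (hX : ∀ x ∈ [vLen, vN, vQ, vS, vT, vK, vBlock], x ∉ X := by decide)
    (hY : aIn ∉ Y := by decide) : Header I m' := by
  simp only [List.mem_cons, List.not_mem_nil, or_false, forall_eq_or_imp, forall_eq] at hX
  obtain ⟨h1, h2, h3, h4, h5, h6, h7⟩ := hX
  exact ⟨fun i => (hF.arr _ hY i).trans (h.input i), (hF.var _ h1).trans h.len,
    (hF.var _ h2).trans h.n, (hF.var _ h3).trans h.q, (hF.var _ h4).trans h.s,
    (hF.var _ h5).trans h.t, (hF.var _ h6).trans h.k, (hF.var _ h7).trans h.block⟩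

theorem Header.run (h : Header I m) (c : Cmd)
    (hX : ∀ x ∈ [vLen, vN, vQ, vS, vT, vK, vBlock], x ∉ c.vars := by decide)
    (hY : aIn ∉ c.arrs := by decide) : Header I (c.run m) :=
  h.frame (c.frame_run m) hX hY

theorem readHeader_spec (I : KPathsInstance) : Header I (readHeader.run (initial I.encode)) := by
  constructor
  · intro i
    rw [run_arr (by decide)]
    simp [initial]
  · rw [run_var (by decide)]
    simp [initial]
  all_goals simp [readHeader, block, Cmd.run, initial, I.encode_eq]

theorem computeBase_spec (h : Header I m) :
    (computeBase.run m).var vBase = I.base ∧ (computeBase.run m).var vBound = I.codeBound ∧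
      ∀ i ≤ I.n + 1, (computeBase.run m).arr aPow i = I.n ^ i := by
  set m₁ := (assign vBase 1).run m with hm₁
  have e₁ : Header I m₁ := h.run _
  set m₂ := (loop vI vLen (assign vBase (var vBase + cell aIn (var vI)))).run m₁ with hm₂
  have e₂ : Header I m₂ := e₁.run _
  have h2 : m₂.var vBase = I.encode.sum + 1 := by
    have := loop_induction (m := m₁) (x := vI) (y := vLen)
      (c := assign vBase (var vBase + cell aIn (var vI)))
      (fun i m' => m'.var vBase = (I.encode.take i).sum + 1) (by simp [hm₁, Cmd.run]) (by
        intro i m' hi hx hF ih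
        rw [e₁.len] at hi
        have e' := e₁.frame hF
        simp [Cmd.run, hx, ih, e'.input, List.sum_take_succ _ _ hi, hi]
        omega)
    rw [e₁.len, List.take_length] at this
    exact this
  set m₃ := (block [assign vBase (var vBase * var vN), store aPow 0 1]).run m₂ with hm₃
  have e₃ : Header I m₃ := e₂.run _
  have h3 : m₃.var vBase = I.base := by
    simp [hm₃, block, Cmd.run, h2, e₂.n, KPathsInstance.base]
  set m₄ := (loop vI vN (store aPow (var vI + 1) (cell aPow (var vI) * var vN))).run m₃ with hm₄
  have e₄ : Header I m₄ := e₃.run _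
  have h4 : ∀ i ≤ I.n, m₄.arr aPow i = I.n ^ i := by
    have := loop_induction (m := m₃) (x := vI) (y := vN)
      (c := store aPow (var vI + 1) (cell aPow (var vI) * var vN))
      (fun i m' => ∀ j ≤ i, m'.arr aPow j = I.n ^ j) (by simp [hm₃, block, Cmd.run]) (by
        intro i m' hi hx hF ih j hj
        have e' := e₃.frame hF
        by_cases hji : j = i + 1
        · simp [Cmd.run, hx, hji, ih i le_rfl, e'.n, pow_succ]
        · simp [Cmd.run, hx, hji, ih j (by omega)])
    rwa [e₃.n] at this
  have h3' : m₄.var vBase = I.base := (run_var (by decide) _).trans h3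
  have hrun : computeBase.run m = (block [assign vBound (cell aPow (var vN) * var vN),
    store aPow (var vN + 1) (var vBound)]).run m₄ := rfl
  rw [hrun]
  refine ⟨(run_var (by decide) _).trans h3', ?_, fun i hi => ?_⟩
  · simp [block, Cmd.run, e₄.n, h4 I.n le_rfl, KPathsInstance.codeBound, pow_succ]
  · by_cases hin : i = I.n + 1
    · simp [block, Cmd.run, e₄.n, h4 I.n le_rfl, hin, pow_succ]
    · simp [block, Cmd.run, e₄.n, hin, h4 i (by omega)]

theorem computeInf_spec (h : Header I m) (hb : m.var vBase = I.base) :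
    (computeInf.run m).var vInf = I.inf := by
  set m₁ := (assign vInf 1).run m with hm₁
  have e₁ : Header I m₁ := h.run _
  have := loop_induction (m := m₁) (x := vI) (y := vQ) (c := assign vInf (var vInf * var vBase))
    (fun i m' => m'.var vInf = I.base ^ i) (by simp [hm₁, Cmd.run]) (by
      intro i m' hi hx hF ih
      have hb' : m'.var vBase = I.base := (hF.var' vBase).trans ((run_var (by decide) _).trans hb)
      simp [Cmd.run, ih, hb', pow_succ])
  rw [e₁.q] at this
  exact this

theorem computeArc_spec (h : Header I m) (hb : m.var vBase = I.base) (hinf : m.var vInf = I.inf)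
    (u v : Fin I.n) (hu : m.var vI = u) (hv : m.var vJ = v) (i : ℕ) :
    (computeArc.run m).arr aArc i = if i = u * I.n + v then I.arc u v else m.arr aArc i := by
  set m₁ := (block [assign vX ((var vI * var vN + var vJ) * var vBlock + 5), assign vAcc 0]).run m
    with hm₁
  have e₁ : Header I m₁ := h.run _
  have hx₁ : m₁.var vX = (u * I.n + v) * (I.q + 1) + 5 := by
    simp [hm₁, block, Cmd.run, hu, hv, h.n, h.block]
  set m₂ := (loop vV vQ (assign vAcc (var vAcc * var vBase +
    cell aIn (var vX + 1 + var vV)))).run m₁ with hm₂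
  have e₂ : Header I m₂ := e₁.run _
  have h2 : m₂.var vAcc =
      horner I.base (fun i => I.encode.getD ((u * I.n + v) * (I.q + 1) + 5 + 1 + i) 0) I.q := by
    have := loop_induction (m := m₁) (x := vV) (y := vQ)
      (c := assign vAcc (var vAcc * var vBase + cell aIn (var vX + 1 + var vV)))
      (fun i m' => m'.var vAcc =
        horner I.base (fun i => I.encode.getD ((u * I.n + v) * (I.q + 1) + 5 + 1 + i) 0) i)
      (by simp [hm₁, block, Cmd.run, horner]) (by
        intro i m' hi hx hF ih
        have e' := e₁.frame hF
        have hb' : m'.var vBase = I.base := (hF.var' vBase).trans ((run_var (by decide) _).trans hb)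
        have hx' := (hF.var' vX).trans hx₁
        simp [Cmd.run, ih, hb', hx, hx', e'.input, horner])
    rwa [e₁.q] at this
  have hx₂ : m₂.var vX = (u * I.n + v) * (I.q + 1) + 5 := (run_var (by decide) _).trans hx₁
  have hI₂ : m₂.var vI = u :=
    (run_var (by decide) _).trans ((run_var (by decide) _).trans hu)
  have hJ₂ : m₂.var vJ = v :=
    (run_var (by decide) _).trans ((run_var (by decide) _).trans hv)
  have hinf₂ : m₂.var vInf = I.inf :=
    (run_var (by decide) _).trans ((run_var (by decide) _).trans hinf)
  set c₃ := ite (cell aIn (var vX)) skip (assign vAcc (var vInf)) with hc₃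
  set m₃ := c₃.run m₂ with hm₃
  -- For `u = t` the value obtained so far is not the weight of the arc in general; it is replaced
  -- afterwards.
  have h3 : u ≠ I.t → m₃.var vAcc = I.arc u v := by
    intro hut
    have hz : (cell aIn (var vX)).eval m₂ ≠ 0 ↔ I.G.Adj u v := by
      rw [← I.encode_adj u v, eval_cell, eval_var, hx₂, e₂.input]
    rw [KPathsInstance.arc, if_neg hut, hm₃, hc₃, Cmd.run]
    by_cases hadj : I.G.Adj u v
    · rw [if_pos (hz.2 hadj), if_pos hadj, Cmd.run, h2]
      exact horner_congr fun i hi => I.encode_weight hadj hi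
    · rw [if_neg (fun h' => hadj (hz.1 h')), if_neg hadj]
      simp [Cmd.run, hinf₂]
  have e₃ : Header I m₃ := e₂.run _
  have hI₃ : m₃.var vI = u := (run_var (by decide) _).trans hI₂
  have hJ₃ : m₃.var vJ = v := (run_var (by decide) _).trans hJ₂
  have hinf₃ : m₃.var vInf = I.inf := (run_var (by decide) _).trans hinf₂
  set c₄ := ite ((var vI - var vT) + (var vT - var vI)) skip
      (ite ((var vJ - var vT) + (var vT - var vJ)) (assign vAcc (var vInf)) (assign vAcc 0)) with hc₄
  set m₄ := c₄.run m₃ with hm₄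
  have ne_iff : ∀ a b : Fin I.n, (a : ℕ) - b + (b - a) ≠ 0 ↔ a ≠ b := by
    intro a b
    rw [ne_eq, ne_eq, Fin.ext_iff]
    omega
  have h4 : m₄.var vAcc = I.arc u v := by
    simp only [hm₄, hc₄, Cmd.run, eval_add, eval_sub, eval_var, hI₃, hJ₃, e₃.t, ne_iff]
    split_ifs with h₁ h₂
    · exact h3 h₁
    · rw [not_not] at h₁
      simp [KPathsInstance.arc, h₁, h₂, hinf₃]
    · rw [not_not] at h₁ h₂
      simp [KPathsInstance.arc, h₁, h₂]
  have e₄ : Header I m₄ := e₃.run _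
  have hI₄ : m₄.var vI = u := (run_var (by decide) _).trans hI₃
  have hJ₄ : m₄.var vJ = v := (run_var (by decide) _).trans hJ₃
  have hA₄ : m₄.arr aArc i = m.arr aArc i := by
    rw [hm₄, run_arr (by decide), hm₃, run_arr (by decide), hm₂, run_arr (by decide), hm₁,
      run_arr (by decide)]
  have hrun : computeArc.run m = (store aArc (var vI * var vN + var vJ) (var vAcc)).run m₄ := rfl
  rw [hrun]
  simp [Cmd.run, hI₄, hJ₄, h4, hA₄, e₄.n]

theorem computeArcs_spec (h : Header I m) (hb : m.var vBase = I.base) (hinf : m.var vInf = I.inf) :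
    ∀ u < I.n, ∀ v < I.n, (computeArcs.run m).arr aArc (u * I.n + v) = I.arcN u v := by
  have := loop_induction (m := m) (x := vI) (y := vN) (c := loop vJ vN computeArc)
    (fun i m' => ∀ u < i, ∀ v < I.n, m'.arr aArc (u * I.n + v) = I.arcN u v) (by simp) (by
      intro i m' hi hx hF ih
      rw [h.n] at hi
      have e' := h.frame hF
      have hb' := (hF.var' vBase).trans hb
      have hinf' := (hF.var' vInf).trans hinf
      have := loop_induction (m := m') (x := vJ) (y := vN) (c := computeArc)
        (fun j m'' => (∀ u < i, ∀ v < I.n, m''.arr aArc (u * I.n + v) = I.arcN u v) ∧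
          ∀ v < j, m''.arr aArc (i * I.n + v) = I.arcN i v) (by simpa using ih) (by
          intro j m'' hj hx' hF' ⟨ih1, ih2⟩
          rw [e'.n] at hj
          have spec := computeArc_spec (e'.frame hF') ((hF'.var' vBase).trans hb')
            ((hF'.var' vInf).trans hinf') ⟨i, hi⟩ ⟨j, hj⟩ ((hF'.var' vI).trans hx) hx'
          refine ⟨fun u hu v hv => ?_, fun v hv => ?_⟩
          · rw [State.setVar_arr, spec, if_neg, ih1 u hu v hv]
            intro e
            exact hu.ne (row_injective hv hj e).1
          · rw [State.setVar_arr, spec]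
            split_ifs with e
            · rw [(row_injective (by omega) hj e).2]
              exact (I.arcN_val ⟨i, hi⟩ ⟨j, hj⟩).symm
            · refine ih2 v ?_
              rcases Nat.lt_succ_iff_lt_or_eq.1 hv with hv | rfl
              · exact hv
              · exact absurd rfl e)
      rw [e'.n] at this
      intro u hu v hv
      rw [State.setVar_arr]
      rcases Nat.lt_succ_iff_lt_or_eq.1 hu with hu | rfl
      · exact this.1 u hu v hv
      · exact this.2 v hv)
  rw [h.n] at this
  exact this

theorem writePath_spec (h : Env I m) (P : I.G.Path I.s I.t)
    (hc : m.var vCode = code P.1.getVert I.n) :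
    (∀ i < m.var vPos, (writePath.run m).arr aOut i = m.arr aOut i) ∧
      (writePath.run m).arr aOut (m.var vPos) = P.1.length + 1 ∧
      (∀ j ≤ P.1.length, (writePath.run m).arr aOut (m.var vPos + 1 + j) = P.1.getVert j) ∧
      (writePath.run m).var vPos = m.var vPos + 1 + (P.1.length + 1) := by
  have hlen := I.length_lt_n P
  -- A path is at `t` only at its end, so the number of digits other than `t` is its length.
  have hvert : ∀ j < I.n, P.1.getVert j ≠ I.t ↔ j < P.1.length := by
    intro j _
    constructor
    · intro hne
      by_contra hj
      exact hne (P.1.getVert_of_length_le (by omega))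
    · intro hj e
      exact hj.ne ((P.2.getVert_eq_end_iff hj.le).1 e)
  set p := m.var vPos with hp
  set m₁ := (assign vCount 1).run m with hm₁
  have e₁ : Env I m₁ := h.run _
  set c := block [
    assign vX (digitExpr (var vCode) (var vJ)),
    store aOut (var vPos + 1 + var vJ) (var vX),
    ite ((var vX - var vT) + (var vT - var vX)) (assign vCount (var vCount + 1)) skip] with hcdef
  set m₂ := (loop vJ vN c).run m₁ with hm₂
  have h2 : (∀ i ≤ p, m₂.arr aOut i = m.arr aOut i) ∧
      (∀ j < I.n, m₂.arr aOut (p + 1 + j) = P.1.getVert j) ∧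
      m₂.var vCount = min I.n P.1.length + 1 := by
    have := loop_induction (m := m₁) (x := vJ) (y := vN) (c := c)
      (fun j m' => (∀ i ≤ p, m'.arr aOut i = m.arr aOut i) ∧
        (∀ j' < j, m'.arr aOut (p + 1 + j') = P.1.getVert j') ∧
        m'.var vCount = min j P.1.length + 1) (by simp [hm₁, Cmd.run]) (by
        intro j m' hj hx hF ⟨ih1, ih2, ih3⟩
        rw [e₁.n] at hj
        have e' := e₁.frame hF
        have hc' : m'.var vCode = code P.1.getVert I.n :=
          (hF.var' vCode).trans ((run_var (by decide) _).trans hc)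
        have hp' : m'.var vPos = p := (hF.var' vPos).trans (run_var (by decide) _)
        have hd := e'.eval_digitExpr (var vCode) (var vJ) (by simp [hx]; omega)
        simp only [eval_var, hc', hx, digit_code P.1.getVert hj.le] at hd
        have hout : ∀ i, (c.run m').arr aOut i =
            if i = p + 1 + j then ((P.1.getVert j : Fin I.n) : ℕ) else m'.arr aOut i := by
          intro i
          have : (c.run m').arr aOut i = ((block [assign vX (digitExpr (var vCode) (var vJ)),
              store aOut (var vPos + 1 + var vJ) (var vX)]).run m').arr aOut i :=
            run_arr (c := ite ((var vX - var vT) + (var vT - var vX))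
              (assign vCount (var vCount + 1)) skip) (by decide) _ _
          rw [this]
          simp [block, Cmd.run, hd, hx, hp']
        have hcount : (c.run m').var vCount = min (j + 1) P.1.length + 1 := by
          have hv := hvert j hj
          rw [ne_eq, Fin.ext_iff] at hv
          set m'' := (block [assign vX (digitExpr (var vCode) (var vJ)),
            store aOut (var vPos + 1 + var vJ) (var vX)]).run m' with hm''
          have hX : m''.var vX = P.1.getVert j := by simp [hm'', block, Cmd.run, hd]
          have hT : m''.var vT = I.t := (e'.run _).t
          have hC : m''.var vCount = min j P.1.length + 1 := (run_var (by decide) _).trans ih3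
          change ((ite ((var vX - var vT) + (var vT - var vX))
            (assign vCount (var vCount + 1)) skip).run m'').var vCount = _
          simp only [Cmd.run, eval_add, eval_sub, eval_var, hX, hT]
          split_ifs
          · simp [hC]
            omega
          · rw [hC]
            omega
        refine ⟨fun i hi => ?_, fun j' hj' => ?_, by simpa using hcount⟩
        · rw [State.setVar_arr, hout, if_neg (by omega)]
          exact ih1 i hi
        · rw [State.setVar_arr, hout]
          split_ifs with e
          · rw [show j' = j by omega]
          · exact ih2 j' (by omega))
    rwa [e₁.n] at this
  have hp₂ : m₂.var vPos = p := (run_var (by decide) _).trans (run_var (by decide) _)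
  have hrun : writePath.run m = (block [store aOut (var vPos) (var vCount),
    assign vPos (var vPos + 1 + var vCount)]).run m₂ := rfl
  have hcount : m₂.var vCount = P.1.length + 1 := by rw [h2.2.2]; omega
  rw [hrun]
  refine ⟨fun i hi => ?_, ?_, fun j hj => ?_, ?_⟩
  · simp [block, Cmd.run, hp₂, hi.ne, h2.1 i hi.le]
  · simp [block, Cmd.run, hp₂, hcount]
  · simp [block, Cmd.run, hp₂, show p + 1 + j ≠ p by omega, h2.2.1 j (by omega)]
  · simp [block, Cmd.run, hp₂, hcount]

theorem writeOutput_spec (h : Env I m) {r : ℕ} (hr : m.var vBeam = r) (hrk : r ≤ I.k)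
    (P : Fin r → I.G.Path I.s I.t)
    (hP : ∀ i : Fin r, m.arr aBeam i = code (P i).1.getVert I.n) :
    (writeOutput.run m).Holds (I.encodePaths (List.ofFn P)) := by
  set enc : I.G.Path I.s I.t → List ℕ :=
    fun P => P.1.support.length :: P.1.support.map fun v => v.val with henc
  set L := List.ofFn P with hL
  have hLlen : L.length = r := by simp [hL]
  set m₁ := (block [store aOut 0 (var vBeam), assign vPos 1]).run m with hm₁
  have e₁ : Env I m₁ := h.run _
  set c := ite (var vBeam - var vI)
    (block [assign vCode (cell aBeam (var vI)), writePath]) skip with hc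
  -- The invariant speaks only of cells before `vPos`, so the padding that `writePath` leaves behind
  -- does no harm.
  have key := loop_induction (m := m₁) (x := vI) (y := vK) (c := c)
    (fun i m' => m'.var vPos = (r :: (L.take i).flatMap enc).length ∧
      ListPrefix (r :: (L.take i).flatMap enc) (m'.arr aOut)) (by
        constructor
        · simp [hm₁, block, Cmd.run]
        · intro i hi
          simp only [List.take_zero, List.flatMap_nil, List.length_cons, List.length_nil] at hi
          obtain rfl : i = 0 := by omega
          simp [hm₁, block, Cmd.run, hr]) (by
      intro i m' hi hx hF ⟨ih1, ih2⟩
      have e' := e₁.frame hF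
      have hr' : m'.var vBeam = r := (hF.var' vBeam).trans ((run_var (by decide) _).trans hr)
      simp only [hc, Cmd.run, eval_sub, eval_var, hr', hx, State.setVar_arr]
      split_ifs with hlt
      · have hir : i < r := by omega
        set m'' := (assign vCode (cell aBeam (var vI))).run m' with hm''
        have e'' : Env I m'' := e'.run _
        have hcode : m''.var vCode = code (P ⟨i, hir⟩).1.getVert I.n := by
          rw [← hP ⟨i, hir⟩]
          simp only [hm'', Cmd.run, State.setVar_var, if_true, eval_cell, eval_var, hx]
          rw [hF.arr' aBeam (by decide), hm₁, run_arr (by decide)]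
        obtain ⟨s1, s2, s3, s4⟩ := writePath_spec e'' _ hcode
        have hpos : m''.var vPos = (r :: (L.take i).flatMap enc).length :=
          (run_var (by decide) _).trans ih1
        rw [hpos] at s1 s2 s3 s4
        have htake : r :: (L.take (i + 1)).flatMap enc =
            (r :: (L.take i).flatMap enc) ++ enc (P ⟨i, hir⟩) := by
          rw [List.take_succ_eq_append_getElem (by omega), List.flatMap_append]
          simp [hL]
        rw [htake]
        have hrun : (block [assign vCode (cell aBeam (var vI)), writePath]).run m' =
          writePath.run m'' := rfl
        rw [hrun]
        refine ⟨?_, ih2.append (g := (writePath.run m'').arr aOut) (fun j hj => ?_)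
          (fun j hj => ?_)⟩
        · rw [State.setVar_var, if_neg (by decide), s4, List.length_append]
          simp [henc]
          omega
        · rw [s1 j hj, hm'']
          rfl
        · cases j with
          | zero =>
            rw [add_zero, s2]
            simp [henc]
          | succ j =>
            have hj' : j ≤ (P ⟨i, hir⟩).1.length := by
              simp [henc] at hj
              omega
            rw [show ∀ a : ℕ, a + (j + 1) = a + 1 + j by intro a; omega, s3 j hj',
              SimpleGraph.Walk.getVert_eq_support_getElem _ hj']
            simp [henc]
      · rw [List.take_of_length_le (by omega)] at ih1 ih2 ⊢
        exact ⟨by simpa using ih1, ih2⟩)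
  rw [e₁.k, List.take_of_length_le (by omega)] at key
  have hout : I.encodePaths L = r :: L.flatMap enc := by
    rw [KPathsInstance.encodePaths, hLlen]
  have hrun : writeOutput.run m = (assign vLen (var vPos)).run ((loop vI vK c).run m₁) := rfl
  rw [hrun, hout]
  exact ⟨by simpa [Cmd.run] using key.1, key.2⟩

end Ram

namespace Ram

/-! ## Programs with several phases -/

/-- The sequential composition of the translations of a list of programs. -/
def phasesProg : List Cmd → Prog
  | [] => .skip
  | c :: l => .seq c.toProg (phasesProg l)

/-- The final state of a run of a list of programs. -/
def phasesRun : List Cmd → State → State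
  | [], m => m
  | c :: l, m => phasesRun l (c.run m)

/-- Every phase is tame, and its loop bounds are at most `L`. -/
def PhasesBounded (L : ℕ) : List Cmd → State → Prop
  | [], _ => True
  | c :: l, m => c.Tame c.vars c.arrs ∧ (∀ y ∈ c.bounds, m.var y ≤ L) ∧ PhasesBounded L l (c.run m)

/-- The running time of a list of programs, relative to the size of the numbers in the memory. -/
noncomputable def phasesWeight : List Cmd → Polynomial ℕ
  | [] => 1
  | c :: l => c.weight * (c.weight + 1) + phasesWeight l * (c.weight + 2)

/-- Each phase multiplies the bound for the length of the numbers by a polynomial in `L`. The list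
of phases does not depend on the input, so the product of these factors is again a polynomial. -/
theorem exec_phases {L : ℕ} (l : List Cmd) {m : State} {S : ℕ} (hl : PhasesBounded L l m)
    (hS : m.Bounded S) :
    ∃ t, Exec (phasesProg l) m (phasesRun l m) t ∧ t ≤ (phasesWeight l).eval L * (S + 1) := by
  induction l generalizing m S with
  | nil => exact ⟨1, .skip m, by simp [phasesWeight]⟩
  | cons c l ih =>
    obtain ⟨⟨t, ht, htle⟩, hS'⟩ := Cmd.exec_phase hl.1 hS hl.2.1
    obtain ⟨u, hu, hule⟩ := ih hl.2.2 hS'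
    refine ⟨t + u, .seq ht hu, ?_⟩
    simp only [phasesWeight, Polynomial.eval_add, Polynomial.eval_mul, Polynomial.eval_one,
      Polynomial.eval_ofNat]
    have h1 : (c.weight.eval L + 1) * (S + 1) + 1 ≤ (c.weight.eval L + 2) * (S + 1) := by nlinarith
    have h2 := Nat.mul_le_mul_left ((phasesWeight l).eval L) h1
    calc t + u ≤ _ := Nat.add_le_add htle (hule.trans h2)
      _ = _ := by ring

theorem length_le_bitLength (l : List ℕ) : l.length ≤ bitLength l := by
  induction l with
  | nil => simp
  | cons a l ih =>
    simp only [bitLength, List.map_cons, List.sum_cons, List.length_cons] at ih ⊢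
    omega

theorem size_getD_le_bitLength (l : List ℕ) (i : ℕ) : (l.getD i 0).size ≤ bitLength l := by
  induction l generalizing i with
  | nil => simp
  | cons a l ih =>
    simp only [bitLength, List.map_cons, List.sum_cons] at ih ⊢
    cases i with
    | zero => simp; omega
    | succ i => have := ih i; simp only [List.getD_cons_succ]; omega

theorem initial_bounded (l : List ℕ) : (initial l).Bounded (bitLength l) := by
  constructor
  · intro x
    simp only [initial]
    split_ifs
    · exact (Nat.size_le.2 Nat.lt_two_pow_self).trans (length_le_bitLength l)
    · simp
  · intro a i
    simp only [initial]
    split_ifs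
    · exact size_getD_le_bitLength l i
    · simp

/-- The phases of the algorithm. -/
def kPaths : List Cmd :=
  [readHeader, computeBase, computeInf, computeArcs, beamSearch, writeOutput]

theorem kPaths_spec (I : KPathsInstance) :
    PhasesBounded (bitLength I.encode + I.k) kPaths (initial I.encode) ∧
      ∃ L, I.IsSolution L ∧ (phasesRun kPaths (initial I.encode)).Holds (I.encodePaths L) := by
  -- `k` bounds loops but is written in binary, so the bit length alone does not bound the numbers
  -- of rounds.
  set N := bitLength I.encode + I.k with hN
  have hlen : I.encode.length ≤ N := (length_le_bitLength _).trans (Nat.le_add_right _ _)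
  have hn0 := I.n_pos
  -- The matrix has `n * n * (q + 1)` entries with `n` positive, so the length of the input bounds
  -- `n` and `q`.
  have hq' : I.q + 1 ≤ I.n * (I.q + 1) := Nat.le_mul_of_pos_left _ hn0
  have hn' : I.n ≤ I.n * (I.q + 1) := Nat.le_mul_of_pos_right _ (by omega)
  have hnn : I.n * (I.q + 1) ≤ I.n * (I.n * (I.q + 1)) := Nat.le_mul_of_pos_left _ hn0
  have henc := I.length_encode
  have hn : I.n ≤ N := by omega
  have hq : I.q ≤ N := by omega
  have hk : I.k ≤ N := by omega
  set m₁ := readHeader.run (initial I.encode)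
  have h₁ : Header I m₁ := readHeader_spec I
  set m₂ := computeBase.run m₁
  have h₂ : Header I m₂ := h₁.run _
  obtain ⟨hbase₂, hbound₂, hpow₂⟩ := computeBase_spec h₁
  set m₃ := computeInf.run m₂
  have h₃ : Header I m₃ := h₂.run _
  have hinf₃ : m₃.var vInf = I.inf := computeInf_spec h₂ hbase₂
  have hbase₃ : m₃.var vBase = I.base := (Cmd.run_var (by decide) _).trans hbase₂
  set m₄ := computeArcs.run m₃
  have h₄ : Header I m₄ := h₃.run _
  have e₄ : Env I m₄ := by
    refine ⟨h₄.n, h₄.s, h₄.t, h₄.k, (Cmd.run_var (by decide) _).trans hinf₃, ?_, fun i hi => ?_,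
      computeArcs_spec h₃ hbase₃ hinf₃⟩
    · exact (Cmd.run_var (by decide) _).trans ((Cmd.run_var (by decide) _).trans hbound₂)
    · exact (Cmd.run_arr (by decide) _ _).trans ((Cmd.run_arr (by decide) _ _).trans (hpow₂ i hi))
  set m₅ := beamSearch.run m₄
  have e₅ : Env I m₅ := e₄.run _
  have hbeam := beamSearch_spec e₄
  have bounds : ∀ {c : Cmd} {m : State} (B : List ℕ), c.bounds ⊆ B → (∀ y ∈ B, m.var y ≤ N) →
      ∀ y ∈ c.bounds, m.var y ≤ N := fun B hB h y hy => h y (hB hy)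
  refine ⟨⟨readHeader_tame, bounds [] (by decide) (by simp), computeBase_tame,
    bounds [vLen, vN] (by decide) ?_, computeInf_tame, bounds [vQ] (by decide) ?_,
    computeArcs_tame, bounds [vN, vQ] (by decide) ?_, beamSearch_tame,
    bounds [vN, vK] (by decide) ?_, writeOutput_tame, bounds [vN, vK] (by decide) ?_, trivial⟩, ?_⟩
  · intro y hy
    fin_cases hy
    exacts [h₁.len.trans_le hlen, h₁.n.trans_le hn]
  · intro y hy
    fin_cases hy
    exact h₂.q.trans_le hq
  · intro y hy
    fin_cases hy
    exacts [h₃.n.trans_le hn, h₃.q.trans_le hq]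
  · intro y hy
    fin_cases hy
    exacts [e₄.n.trans_le hn, e₄.k.trans_le hk]
  · intro y hy
    fin_cases hy
    exacts [e₅.n.trans_le hn, e₅.k.trans_le hk]
  · obtain ⟨P, hP, hsol⟩ := hbeam.exists_isSolution
    exact ⟨List.ofFn P, hsol, writeOutput_spec e₅ rfl hbeam.le P hP⟩

end Ram

theorem theorem1 :
    ∃ (A : Ram.Prog) (p : Polynomial ℕ), ∀ I : KPathsInstance,
      ∃ L : List (I.G.Path I.s I.t), I.IsSolution L ∧
        A.ComputesWithin I.encode (I.encodePaths L)
          (p.eval (Ram.bitLength I.encode + I.k)) := by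
  -- The factor `X + 1` accounts for the lengths of the initial numbers, which are at most the bit
  -- length of the input.
  refine ⟨Ram.phasesProg Ram.kPaths, Ram.phasesWeight Ram.kPaths * (Polynomial.X + 1), fun I => ?_⟩
  obtain ⟨hb, L, hL, hout⟩ := Ram.kPaths_spec I
  obtain ⟨t, ht, hle⟩ := Ram.exec_phases Ram.kPaths hb (Ram.initial_bounded I.encode)
  refine ⟨L, hL, _, t, ht, hout, hle.trans ?_⟩
  simp only [Polynomial.eval_mul, Polynomial.eval_add, Polynomial.eval_X, Polynomial.eval_one]
  exact Nat.mul_le_mul_left _ (by omega)
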